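/- There is an absolute constant $C>0$ such that for every dimension $d\ge 1$, every $\varepsilon>0$ and every integer $n\ge C\,d/\varepsilon$ there is a two-outcome measurement $\{E_{\mathrm{diag}},E_{\mathrm{far}}\}$ on $(\mathbb{C}^d)^{\otimes n}$ (positive semidefinite operators with $E_{\mathrm{diag}}+E_{\mathrm{far}}=I$), depending only on $d,\varepsilon,n$, with the following property. For every $d$-dimensional mixed state $\rho$ (a positive semidefinite $d\times d$ complex matrix of trace one), when the measurement is applied to $\rho^{\otimes n}$: (i) if $\rho$ is diagonal in the standard basis, then the outcome is "diag" with probability $\operatorname{tr}(\rho^{\otimes n}E_{\mathrm{diag}})\ge 2/3$; (ii) if $1-F(\rho,\sigma)>\varepsilon$ for every state $\sigma$ that is diagonal in the standard basis, where $F(\rho,\sigma)=\|\sqrt{\rho}\sqrt{\sigma}\|_1$ is the (unsquared) fidelity and $\|\cdot\|_1$ the trace norm, then the outcome is "far" with probability $\operatorname{tr}(\rho^{\otimes n}E_{\mathrm{far}})\ge 2/3$. In particular $n=O(d/\varepsilon)$ copies of $\rho$ suffice to distinguish the two cases with high probability. -/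

import Mathlib

open scoped ComplexOrder MatrixOrder Matrix

/-- A (mixed) quantum state on `ℂ^ι`: a positive semidefinite matrix of trace one. -/
structure QState (ι : Type*) [Fintype ι] where
  mat : Matrix ι ι ℂ
  posSemidef : mat.PosSemidef
  trace_eq_one : mat.trace = 1

/-- A positive-operator valued measurement on `ℂ^ι` with finitely many outcomes `κ`:
positive semidefinite matrices summing to the identity. -/
structure POVM (ι κ : Type*) [Fintype ι] [DecidableEq ι] [Fintype κ] where
  effect : κ → Matrix ι ι ℂ
  posSemidef : ∀ k, (effect k).PosSemidef
  sum_eq_one : ∑ k, effect k = 1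

/-- The probability `tr(ρ E_k)` of outcome `k` when the measurement is applied to `ρ`
(the trace is a nonnegative real number). -/
noncomputable def POVM.prob {ι κ : Type*} [Fintype ι] [DecidableEq ι] [Fintype κ]
    (M : POVM ι κ) (ρ : QState ι) (k : κ) : ℝ :=
  (ρ.mat * M.effect k).trace.re

/-- The matrix of `A^{⊗ n}` on `(ℂ^ι)^{⊗ n}`, in the product basis, indexed by `Fin n → ι`. -/
def tensorPowMat {ι : Type*} (A : Matrix ι ι ℂ) (n : ℕ) :
    Matrix (Fin n → ι) (Fin n → ι) ℂ :=
  Matrix.of fun x y => ∏ i, A (x i) (y i)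

theorem tensorPowMat_posSemidef {ι : Type*} [Fintype ι] {A : Matrix ι ι ℂ}
    (hA : A.PosSemidef) (n : ℕ) : (tensorPowMat A n).PosSemidef := by
  classical
  obtain ⟨B, rfl⟩ := CStarAlgebra.nonneg_iff_eq_star_mul_self.mp hA.nonneg
  rw [Matrix.star_eq_conjTranspose]
  have h : tensorPowMat (Bᴴ * B) n = (tensorPowMat B n)ᴴ * tensorPowMat B n := by
    ext x y
    simp only [tensorPowMat, Matrix.of_apply, Matrix.mul_apply, Matrix.conjTranspose_apply,
      Fintype.prod_sum, star_prod, ← Finset.prod_mul_distrib]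
  rw [h]
  exact Matrix.posSemidef_conjTranspose_mul_self _

theorem tensorPowMat_trace {ι : Type*} [Fintype ι] {A : Matrix ι ι ℂ}
    (hA : A.trace = 1) (n : ℕ) : (tensorPowMat A n).trace = 1 := by
  classical
  have h : (tensorPowMat A n).trace = ∏ _i : Fin n, A.trace := by
    simp only [Matrix.trace, Matrix.diag_apply, tensorPowMat, Matrix.of_apply,
      Fintype.prod_sum]
  rw [h, hA, Finset.prod_const_one]

/-- `n` copies of the state `ρ`, that is, `ρ^{⊗ n}`. -/
def QState.copies {ι : Type*} [Fintype ι] [DecidableEq ι] (ρ : QState ι) (n : ℕ) :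
    QState (Fin n → ι) where
  mat := tensorPowMat ρ.mat n
  posSemidef := tensorPowMat_posSemidef ρ.posSemidef n
  trace_eq_one := tensorPowMat_trace ρ.trace_eq_one n

/-- The trace norm `‖A‖₁ = tr |A|` with `|A| = √(Aᴴ A)`. -/
noncomputable def traceNorm {ι : Type*} [Fintype ι] [DecidableEq ι] (A : Matrix ι ι ℂ) : ℝ :=
  (CFC.sqrt (Aᴴ * A)).trace.re

/-- The (unsquared) fidelity `F(ρ, σ) = ‖√ρ √σ‖₁`. -/
noncomputable def QState.fidelity {ι : Type*} [Fintype ι] [DecidableEq ι]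
    (ρ σ : QState ι) : ℝ :=
  traceNorm (CFC.sqrt ρ.mat * CFC.sqrt σ.mat)

/-- The infidelity `1 - F(ρ, σ)`. -/
noncomputable def QState.infidelity {ι : Type*} [Fintype ι] [DecidableEq ι]
    (ρ σ : QState ι) : ℝ :=
  1 - ρ.fidelity σ

/-- The state is diagonal in the standard basis. -/
def QState.IsDiagonal {ι : Type*} [Fintype ι] (ρ : QState ι) : Prop :=
  ρ.mat.IsDiag

open scoped Kronecker

/-! Write `r i` for the diagonal entries of `ρ`. Infidelity is bounded by the Bures χ²-divergence
(`QState.infidelity_le_chiSq`), so comparing `ρ` with its smoothed diagonal shows that a state far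
from diagonal has S = ∑_{i≠j} |ρ_ij|² / (r_i + r_j + 2/m) of order ε
(`QState.exists_isDiagonal_infidelity_le`), while S = 0 for a diagonal state. It remains to detect
S.

The weights 1/(r_i + r_j) are unknown. Measuring `m` copies in the standard basis gives an i.i.d.
sample from `r`, hence empirical weights w_ij (`invFreq`). On two further blocks of `k` copies, the
observable ∑ w_ij (average of |i⟩⟨j|) ⊗ (average of |j⟩⟨i|) has mean δ = ∑ w_ij |ρ_ij|². Its
variance is at most (2d/k) ∑ r_i w_ij² |ρ_ij|² + (1/k²) ∑ w_ij² r_i r_j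
(`re_trace_mul_exchangeObs_sq_le`). Inverse moments of binomial counts bound the sample averages of
these two sums by S and d²/4.

Thus the averaged variance is of order dS/k + d²/k², small against S² once k is a large multiple of
d/ε. A Cauchy–Schwarz argument (`offDiagChiSq_sq_le`) shows that δ is rarely much smaller than S,
and Chebyshev for spectral projections finishes both cases. -/

/-! ### Infidelity against the Bures χ²-divergence. -/

theorem CFC_sqrt_diagonal {ι : Type*} [Fintype ι] [DecidableEq ι] {s : ι → ℝ}
    (hs : ∀ i, 0 ≤ s i) :
    CFC.sqrt (Matrix.diagonal fun i => (s i : ℂ)) =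
      Matrix.diagonal fun i => ((√(s i) : ℝ) : ℂ) := by
  refine CFC.sqrt_unique ?_ ?_
  · rw [Matrix.diagonal_mul_diagonal]
    congr 1
    ext i
    rw [← Complex.ofReal_mul, Real.mul_self_sqrt (hs i)]
  · rw [Matrix.nonneg_iff_posSemidef]
    exact Matrix.PosSemidef.diagonal fun i => by simp

theorem re_trace_mul_le_sum_norm {ι : Type*} [Fintype ι] (A B : Matrix ι ι ℂ) :
    (A * B).trace.re ≤ ∑ i, ∑ j, ‖A i j‖ * ‖B j i‖ := by
  simp only [Matrix.trace, Matrix.diag_apply, Matrix.mul_apply, Complex.re_sum]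
  refine Finset.sum_le_sum fun i _ => Finset.sum_le_sum fun j _ => ?_
  rw [← norm_mul]
  exact Complex.re_le_norm _

theorem Matrix.IsHermitian.norm_apply_comm {ι : Type*} {A : Matrix ι ι ℂ}
    (hA : A.IsHermitian) (i j : ι) : ‖A j i‖ = ‖A i j‖ := by
  rw [← hA.apply i j, norm_star]

theorem re_trace_mul_self_mul_diagonal {ι : Type*} [Fintype ι] [DecidableEq ι]
    {N : Matrix ι ι ℂ} (hN : N.IsHermitian) (s : ι → ℝ) :
    (N * N * Matrix.diagonal fun i => (s i : ℂ)).trace.re =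
      ∑ i, ∑ j, ‖N i j‖ ^ 2 * s i := by
  simp only [Matrix.trace, Matrix.diag_apply, Matrix.mul_diagonal, Complex.re_sum]
  simp only [Matrix.mul_apply, Complex.re_sum, Finset.sum_mul]
  refine Finset.sum_congr rfl fun i _ => Finset.sum_congr rfl fun j _ => ?_
  rw [← hN.apply j i, Complex.star_def, Complex.mul_conj, ← Complex.ofReal_mul,
    Complex.ofReal_re, Complex.normSq_eq_norm_sq]

/-- For `ρ = M σ M` with `M ≥ 0` and `σ` diagonal, the squared Bures distance
`tr ρ - 2 tr (M σ) + tr σ` is bounded by twice the Bures `χ²`-divergence. -/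
theorem bures_le_chiSq {ι : Type*} [Fintype ι] [DecidableEq ι]
    {M : Matrix ι ι ℂ} (hM : M.PosSemidef) {s : ι → ℝ} (hs : ∀ i, 0 < s i)
    {D : Matrix ι ι ℂ} (hD : D = Matrix.diagonal fun i => (s i : ℂ)) :
    (M * D * M).trace.re - 2 * (M * D).trace.re + D.trace.re ≤
      2 * ∑ i, ∑ j, ‖(M * D * M - D) i j‖ ^ 2 / (s i + s j) := by
  -- The left side is X = tr(N²D). Since tr(NΔ) = X + tr(NMND) and the last term is nonnegative, X ≤
  -- tr(NΔ); an entrywise AM-GM gives tr(NΔ) ≤ X/2 + χ², so X ≤ 2χ².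
  set N := M - 1 with hNdef
  have hN : N.IsHermitian := hM.isHermitian.sub Matrix.isHermitian_one
  have hDps : D.PosSemidef := by
    rw [hD]
    exact Matrix.PosSemidef.diagonal fun i => by simpa using (hs i).le
  have hDh := hDps.isHermitian
  set Δ := M * D * M - D with hΔdef
  have hΔ : Δ.IsHermitian := by
    refine Matrix.IsHermitian.sub ?_ hDh
    have := Matrix.isHermitian_mul_mul_conjTranspose M hDh
    rwa [hM.isHermitian.eq] at this
  have c1 : (M * D * M).trace = (M * M * D).trace := by
    rw [Matrix.trace_mul_comm (M * D), Matrix.mul_assoc]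
  have hX : (N * N * D).trace =
      (M * D * M).trace - 2 * (M * D).trace + D.trace := by
    have : N * N * D = M * M * D - M * D - M * D + D := by rw [hNdef]; noncomm_ring
    rw [this, c1]
    simp only [Matrix.trace_add, Matrix.trace_sub]
    ring
  have hY : (N * Δ).trace = (N * N * D).trace + (N * M * N * D).trace := by
    have e1 : N * Δ = M * M * D * M - M * D * M - M * D + D := by
      rw [hNdef, hΔdef]; noncomm_ring
    have e2 : N * N * D + N * M * N * D = M * M * M * D - M * M * D - M * D + D := by
      rw [hNdef]; noncomm_ring
    have c2 : (M * M * D * M).trace = (M * M * M * D).trace := by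
      rw [Matrix.trace_mul_comm (M * M * D)]
      simp only [Matrix.mul_assoc]
    rw [← Matrix.trace_add, e1, e2]
    simp only [Matrix.trace_add, Matrix.trace_sub, c1, c2]
  have hpos : 0 ≤ (N * M * N * D).trace.re := by
    have h1 : (N * M * N).PosSemidef := by
      have := hM.mul_mul_conjTranspose_same N
      rwa [hN.eq] at this
    rw [hD]
    simp only [Matrix.trace, Matrix.diag_apply, Matrix.mul_diagonal, Complex.re_sum]
    refine Finset.sum_nonneg fun i _ => ?_
    rw [Complex.re_mul_ofReal]
    exact mul_nonneg (Complex.nonneg_iff.mp h1.diag_nonneg).1 (hs i).le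
  have hsum : (N * N * D).trace.re = ∑ i, ∑ j, ‖N i j‖ ^ 2 * ((s i + s j) / 2) := by
    have h1 := re_trace_mul_self_mul_diagonal hN s
    have h2 : ∑ i, ∑ j, ‖N i j‖ ^ 2 * s i = ∑ i, ∑ j, ‖N i j‖ ^ 2 * s j := by
      rw [Finset.sum_comm]
      refine Finset.sum_congr rfl fun i _ => Finset.sum_congr rfl fun j _ => ?_
      rw [hN.norm_apply_comm]
    rw [hD, h1]
    have h3 : ∑ i, ∑ j, ‖N i j‖ ^ 2 * ((s i + s j) / 2) =
        (∑ i, ∑ j, ‖N i j‖ ^ 2 * s i) / 2 + (∑ i, ∑ j, ‖N i j‖ ^ 2 * s j) / 2 := by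
      simp only [Finset.sum_div, ← Finset.sum_add_distrib]
      refine Finset.sum_congr rfl fun i _ => Finset.sum_congr rfl fun j _ => ?_
      ring
    rw [h3, ← h2]
    ring
  have hcs : (N * Δ).trace.re ≤
      (N * N * D).trace.re / 2 + ∑ i, ∑ j, ‖Δ i j‖ ^ 2 / (s i + s j) := by
    refine (re_trace_mul_le_sum_norm N Δ).trans ?_
    rw [hsum]
    simp only [Finset.sum_div, ← Finset.sum_add_distrib]
    refine Finset.sum_le_sum fun i _ => Finset.sum_le_sum fun j _ => ?_
    rw [hΔ.norm_apply_comm]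
    have ht : 0 < s i + s j := add_pos (hs i) (hs j)
    have key : 0 ≤ (‖N i j‖ * (s i + s j) - 2 * ‖Δ i j‖) ^ 2 / (4 * (s i + s j)) := by
      positivity
    have : (‖N i j‖ * (s i + s j) - 2 * ‖Δ i j‖) ^ 2 / (4 * (s i + s j)) =
        ‖N i j‖ ^ 2 * ((s i + s j) / 2) / 2 + ‖Δ i j‖ ^ 2 / (s i + s j)
          - ‖N i j‖ * ‖Δ i j‖ := by
      field_simp
      ring
    linarith
  have hY' := congrArg Complex.re hY
  have hX' := congrArg Complex.re hX
  simp only [Complex.add_re, Complex.sub_re, Complex.mul_re, Complex.re_ofNat,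
    Complex.im_ofNat, zero_mul, sub_zero] at hX' hY'
  linarith

theorem QState.fidelity_nonneg {ι : Type*} [Fintype ι] [DecidableEq ι] (ρ σ : QState ι) :
    0 ≤ ρ.fidelity σ := by
  have h : (CFC.sqrt ((CFC.sqrt ρ.mat * CFC.sqrt σ.mat)ᴴ *
      (CFC.sqrt ρ.mat * CFC.sqrt σ.mat))).PosSemidef :=
    Matrix.nonneg_iff_posSemidef.mp (CFC.sqrt_nonneg _)
  exact (Complex.nonneg_iff.mp h.trace_nonneg).1

theorem QState.infidelity_le_chiSq {ι : Type*} [Fintype ι] [DecidableEq ι] (ρ σ : QState ι)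
    {s : ι → ℝ} (hs : ∀ i, 0 < s i) (hσ : σ.mat = Matrix.diagonal fun i => (s i : ℂ)) :
    ρ.infidelity σ ≤ ∑ i, ∑ j, ‖ρ.mat i j - σ.mat i j‖ ^ 2 / (s i + s j) := by
  set R : Matrix ι ι ℂ := Matrix.diagonal fun i => ((√(s i) : ℝ) : ℂ) with hR
  set R' : Matrix ι ι ℂ := Matrix.diagonal fun i => (((√(s i))⁻¹ : ℝ) : ℂ) with hR'
  have hRh : Rᴴ = R := by
    rw [hR, Matrix.diagonal_conjTranspose]
    congr 1
    ext i
    simp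
  have hR'h : R'ᴴ = R' := by
    rw [hR', Matrix.diagonal_conjTranspose]
    congr 1
    ext i
    simp
  have h0 : ∀ i, √(s i) ≠ 0 := fun i => (Real.sqrt_pos.mpr (hs i)).ne'
  have hRR' : R * R' = 1 := by
    rw [hR, hR', Matrix.diagonal_mul_diagonal, ← Matrix.diagonal_one]
    congr 1
    ext i
    rw [← Complex.ofReal_mul, mul_inv_cancel₀ (h0 i), Complex.ofReal_one]
  have hR'R : R' * R = 1 := by
    rw [hR, hR', Matrix.diagonal_mul_diagonal, ← Matrix.diagonal_one]
    congr 1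
    ext i
    rw [← Complex.ofReal_mul, inv_mul_cancel₀ (h0 i), Complex.ofReal_one]
  have hRR : R * R = σ.mat := by
    rw [hR, hσ, Matrix.diagonal_mul_diagonal]
    congr 1
    ext i
    rw [← Complex.ofReal_mul, Real.mul_self_sqrt (hs i).le]
  have hsq : CFC.sqrt σ.mat = R := by
    rw [hσ, CFC_sqrt_diagonal fun i => (hs i).le]
  have hρρ : CFC.sqrt ρ.mat * CFC.sqrt ρ.mat = ρ.mat :=
    CFC.sqrt_mul_sqrt_self _ (Matrix.nonneg_iff_posSemidef.mpr ρ.posSemidef)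
  have hρh : (CFC.sqrt ρ.mat)ᴴ = CFC.sqrt ρ.mat :=
    (Matrix.nonneg_iff_posSemidef.mp (CFC.sqrt_nonneg ρ.mat)).isHermitian.eq
  have hprod : (CFC.sqrt ρ.mat * CFC.sqrt σ.mat)ᴴ * (CFC.sqrt ρ.mat * CFC.sqrt σ.mat) =
      R * ρ.mat * R := by
    rw [hsq, Matrix.conjTranspose_mul, hρh, hRh, Matrix.mul_assoc R,
      ← Matrix.mul_assoc (CFC.sqrt ρ.mat), hρρ, Matrix.mul_assoc]
  have hRρR : (R * ρ.mat * R).PosSemidef := by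
    have := ρ.posSemidef.mul_mul_conjTranspose_same R
    rwa [hRh] at this
  set P := CFC.sqrt (R * ρ.mat * R) with hP
  have hPP : P * P = R * ρ.mat * R :=
    CFC.sqrt_mul_sqrt_self _ (Matrix.nonneg_iff_posSemidef.mpr hRρR)
  have hPps : P.PosSemidef := Matrix.nonneg_iff_posSemidef.mp (CFC.sqrt_nonneg _)
  -- M = σ^{-1/2} (σ^{1/2} ρ σ^{1/2})^{1/2} σ^{-1/2} is chosen so that MσM = ρ and tr(Mσ) is the
  -- fidelity; the Bures expression then equals 2 - 2F.
  set M := R' * P * R' with hM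
  have hMps : M.PosSemidef := by
    have := hPps.mul_mul_conjTranspose_same R'
    rwa [hR'h] at this
  have hMσ : M * σ.mat = R' * P * R := by
    rw [hM, ← hRR, Matrix.mul_assoc, ← Matrix.mul_assoc R', hR'R, Matrix.one_mul]
  have hMσM : M * σ.mat * M = ρ.mat := by
    calc M * σ.mat * M = R' * P * (R * R') * P * R' := by
          rw [hMσ, hM]; simp only [Matrix.mul_assoc]
      _ = R' * (P * P) * R' := by rw [hRR']; simp only [Matrix.mul_one, Matrix.mul_assoc]
      _ = (R' * R) * ρ.mat * (R * R') := by rw [hPP]; simp only [Matrix.mul_assoc]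
      _ = ρ.mat := by rw [hRR', hR'R, Matrix.one_mul, Matrix.mul_one]
  have htr : (M * σ.mat).trace.re = ρ.fidelity σ := by
    rw [hMσ, Matrix.trace_mul_comm, ← Matrix.mul_assoc, hRR', Matrix.one_mul,
      QState.fidelity, traceNorm, hprod]
  have main := bures_le_chiSq hMps hs hσ
  rw [hMσM, htr, ρ.trace_eq_one, σ.trace_eq_one] at main
  simp only [Matrix.sub_apply, Complex.one_re] at main
  rw [QState.infidelity]
  linarith

/-! ### Inverse moments of binomial counts. -/

/-- The expectation of `φ` over `m` independent samples with common weights `p`. -/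
noncomputable def iidMean {ι : Type*} [Fintype ι] (p : ι → ℝ) (m : ℕ)
    (φ : (Fin m → ι) → ℝ) : ℝ :=
  ∑ x, (∏ t, p (x t)) * φ x

/-- The total number of samples weighted by `f`. -/
def hits {ι : Type*} {m : ℕ} (f : ι → ℕ) (x : Fin m → ι) : ℕ := ∑ t, f (x t)

theorem hits_cons {ι : Type*} {m : ℕ} (f : ι → ℕ) (a : ι) (x : Fin m → ι) :
    hits f (Fin.cons a x : Fin (m + 1) → ι) = f a + hits f x := by
  simp only [hits, Fin.sum_univ_succ, Fin.cons_zero, Fin.cons_succ]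

section iidMean

variable {ι : Type*} [Fintype ι] {p : ι → ℝ} {m : ℕ}

theorem iidMean_add (φ ψ : (Fin m → ι) → ℝ) :
    iidMean p m (fun x => φ x + ψ x) = iidMean p m φ + iidMean p m ψ := by
  simp only [iidMean, mul_add, Finset.sum_add_distrib]

theorem iidMean_const_mul (c : ℝ) (φ : (Fin m → ι) → ℝ) :
    iidMean p m (fun x => c * φ x) = c * iidMean p m φ := by
  simp only [iidMean, Finset.mul_sum]
  exact Finset.sum_congr rfl fun x _ => by ring

theorem iidMean_sum {κ : Type*} (s : Finset κ) (φ : κ → (Fin m → ι) → ℝ) :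
    iidMean p m (fun x => ∑ k ∈ s, φ k x) = ∑ k ∈ s, iidMean p m (φ k) := by
  simp only [iidMean, Finset.mul_sum]
  exact Finset.sum_comm

theorem iidMean_mono (hp : ∀ i, 0 ≤ p i) {φ ψ : (Fin m → ι) → ℝ} (h : ∀ x, φ x ≤ ψ x) :
    iidMean p m φ ≤ iidMean p m ψ :=
  Finset.sum_le_sum fun x _ =>
    mul_le_mul_of_nonneg_left (h x) (Finset.prod_nonneg fun t _ => hp (x t))

theorem iidMean_const (hp1 : ∑ i, p i = 1) (c : ℝ) : iidMean p m (fun _ => c) = c := by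
  have h : ∑ x : Fin m → ι, ∏ t, p (x t) = ∏ _t : Fin m, ∑ i, p i :=
    (Fintype.prod_sum fun (_ : Fin m) i => p i).symm
  rw [iidMean, ← Finset.sum_mul, h, hp1, Finset.prod_const_one, one_mul]

theorem iidMean_succ (φ : (Fin (m + 1) → ι) → ℝ) :
    iidMean p (m + 1) φ = ∑ a, p a * iidMean p m (fun x => φ (Fin.cons a x)) := by
  rw [iidMean, ← (Fin.consEquiv fun _ => ι).sum_comp, Fintype.sum_prod_type]
  refine Finset.sum_congr rfl fun a _ => ?_
  rw [iidMean, Finset.mul_sum]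
  refine Finset.sum_congr rfl fun x _ => ?_
  simp only [Fin.consEquiv_apply, Fin.prod_univ_succ, Fin.cons_zero, Fin.cons_succ, mul_assoc]
  rfl

/-- Condition on the first sample, which is a Bernoulli trial because `f` takes only the values 0
and 1. -/
theorem iidMean_hits_succ (hp1 : ∑ i, p i = 1) {f : ι → ℕ} (hf : ∀ i, f i ≤ 1)
    (g : ℕ → ℝ) :
    iidMean p (m + 1) (fun x => g (hits f x)) =
      (∑ i, p i * f i) * iidMean p m (fun x => g (hits f x + 1)) +
        (1 - ∑ i, p i * f i) * iidMean p m (fun x => g (hits f x)) := by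
  rw [iidMean_succ, ← hp1, ← Finset.sum_sub_distrib, Finset.sum_mul, Finset.sum_mul,
    ← Finset.sum_add_distrib]
  refine Finset.sum_congr rfl fun a _ => ?_
  simp only [hits_cons]
  have := hf a
  interval_cases f a
  · simp
  · simp [add_comm]

/-- Size biasing for a binomial count. -/
theorem iidMean_hits_mul (hp1 : ∑ i, p i = 1) {f : ι → ℕ} (hf : ∀ i, f i ≤ 1)
    (g : ℕ → ℝ) :
    iidMean p (m + 1) (fun x => hits f x * g (hits f x)) =
      (m + 1) * (∑ i, p i * f i) * iidMean p m (fun x => g (hits f x + 1)) := by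
  induction m generalizing g with
  | zero =>
    rw [iidMean_hits_succ hp1 hf fun k => k * g k]
    simp [iidMean, hits]
  | succ m ih =>
    rw [iidMean_hits_succ hp1 hf fun k => k * g k, ih g]
    have h1 : iidMean p (m + 1) (fun x => ((hits f x + 1 : ℕ) : ℝ) * g (hits f x + 1)) =
        iidMean p (m + 1) (fun x => hits f x * g (hits f x + 1)) +
          iidMean p (m + 1) (fun x => g (hits f x + 1)) := by
      rw [← iidMean_add]
      congr 1
      ext x
      push_cast
      ring
    rw [h1, ih fun k => g (k + 1), iidMean_hits_succ hp1 hf fun k => g (k + 1)]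
    push_cast
    ring

theorem iidMean_hits (hp1 : ∑ i, p i = 1) {f : ι → ℕ} (hf : ∀ i, f i ≤ 1)
    : iidMean p m (fun x => (hits f x : ℝ)) = m * ∑ i, p i * f i := by
  cases m with
  | zero => simp [iidMean, hits]
  | succ m =>
    have := iidMean_hits_mul (m := m) hp1 hf fun _ => 1
    simp only [mul_one, iidMean_const hp1] at this
    rw [this]
    push_cast
    ring

/-- The second inverse moment of a shifted binomial count. -/
theorem sq_mul_iidMean_inv_hits_le (hp1 : ∑ i, p i = 1) {f : ι → ℕ} (hf : ∀ i, f i ≤ 1)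
    (hp : ∀ i, 0 ≤ p i) :
    (∑ i, p i * f i) ^ 2 * iidMean p m (fun x => (m / ((hits f x : ℝ) + 2)) ^ 2) ≤ 1 := by
  set P := ∑ i, p i * f i with hP
  have hP0 : 0 ≤ P := Finset.sum_nonneg fun i _ => mul_nonneg (hp i) (Nat.cast_nonneg _)
  -- Size biasing with g(k) = 1/k; since 0⁻¹ = 0, the product k·k⁻¹ is at most 1 even at k = 0. A
  -- second size biasing in `h2` lowers the sample size to `m`, and the shift by 2 in the
  -- denominator is what two such steps produce.
  have h1 : (m + 2) * P * iidMean p (m + 1) (fun x => ((hits f x : ℝ) + 1)⁻¹) ≤ 1 := by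
    have e := iidMean_hits_mul (m := m + 1) hp1 hf fun k => (k : ℝ)⁻¹
    push_cast at e
    have e' : ((m : ℝ) + 2) = m + 1 + 1 := by ring
    rw [e', hP, ← e]
    refine (iidMean_mono hp fun x => ?_).trans (iidMean_const hp1 1).le
    exact mul_inv_le_one
  have h2 : (m + 1) * P * iidMean p m (fun x => ((hits f x : ℝ) + 1)⁻¹ * ((hits f x : ℝ) + 2)⁻¹)
      ≤ iidMean p (m + 1) (fun x => ((hits f x : ℝ) + 1)⁻¹) := by
    have e := iidMean_hits_mul (m := m) hp1 hf fun k => (k : ℝ)⁻¹ * ((k : ℝ) + 1)⁻¹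
    push_cast at e
    simp only [add_assoc, one_add_one_eq_two] at e
    rw [hP, ← e]
    refine iidMean_mono hp fun x => ?_
    rw [← mul_assoc]
    exact mul_le_of_le_one_left (by positivity) mul_inv_le_one
  have h3 : iidMean p m (fun x => (m / ((hits f x : ℝ) + 2)) ^ 2) ≤ (m + 2) * ((m + 1) *
      iidMean p m (fun x => ((hits f x : ℝ) + 1)⁻¹ * ((hits f x : ℝ) + 2)⁻¹)) := by
    rw [← iidMean_const_mul, ← iidMean_const_mul]
    refine iidMean_mono hp fun x => ?_
    have hh : (0 : ℝ) ≤ hits f x := Nat.cast_nonneg _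
    have hm : (0 : ℝ) ≤ m := Nat.cast_nonneg _
    rw [div_pow, div_eq_mul_inv, ← mul_inv, ← mul_assoc]
    refine mul_le_mul (by nlinarith) ?_ (by positivity) (by positivity)
    exact inv_anti₀ (by positivity) (by nlinarith)
  calc _ ≤ P ^ 2 * ((m + 2) * ((m + 1) *
      iidMean p m (fun x => ((hits f x : ℝ) + 1)⁻¹ * ((hits f x : ℝ) + 2)⁻¹))) := by gcongr
    _ = (m + 2) * P * ((m + 1) * P *
      iidMean p m (fun x => ((hits f x : ℝ) + 1)⁻¹ * ((hits f x : ℝ) + 2)⁻¹)) := by ring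
    _ ≤ _ := (mul_le_mul_of_nonneg_left h2 (by positivity)).trans h1

/-- A mixed inverse moment of a shifted binomial count, regularised at scale `2 / m`. -/
theorem mul_iidMean_inv_hits_le (hp1 : ∑ i, p i = 1) {f : ι → ℕ} (hf : ∀ i, f i ≤ 1)
    (hp : ∀ i, 0 ≤ p i) (hm : 0 < m) :
    (∑ i, p i * f i) * iidMean p m (fun x => (m / ((hits f x : ℝ) + 2)) ^ 2) ≤
      2 / ((∑ i, p i * f i) + 2 / m) := by
  have h := sq_mul_iidMean_inv_hits_le (m := m) hp1 hf hp
  set P := ∑ i, p i * f i with hP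
  have hP0 : 0 ≤ P := Finset.sum_nonneg fun i _ => mul_nonneg (hp i) (Nat.cast_nonneg _)
  have hm' : (0 : ℝ) < m := Nat.cast_pos.mpr hm
  rw [le_div_iff₀ (by positivity)]
  -- The shift forces w ≤ m/2, so P(2/m)w² ≤ Pw ≤ (1 + P²w²)/2, and the previous moment bound
  -- applies to P²w².
  have h2 : P * (2 / m) * iidMean p m (fun x => (m / ((hits f x : ℝ) + 2)) ^ 2) ≤ 1 := by
    have : P * (2 / m) * iidMean p m (fun x => (m / ((hits f x : ℝ) + 2)) ^ 2) ≤
        iidMean p m (fun x => 1 / 2 + (1 / 2) * (P ^ 2 * (m / ((hits f x : ℝ) + 2)) ^ 2)) := by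
      rw [← iidMean_const_mul]
      refine iidMean_mono hp fun x => ?_
      have hh : (0 : ℝ) ≤ hits f x := Nat.cast_nonneg _
      set w : ℝ := m / ((hits f x : ℝ) + 2) with hw
      have hw0 : 0 ≤ w := by positivity
      have hw1 : 2 / m * w ≤ 1 := by
        rw [hw, div_mul_div_comm, div_le_one (by positivity)]
        nlinarith
      have : P * (2 / m) * w ^ 2 = (P * w) * (2 / m * w) := by ring
      rw [this]
      have h3 : (P * w) * (2 / m * w) ≤ P * w := mul_le_of_le_one_right (by positivity) hw1
      nlinarith [sq_nonneg (P * w - 1)]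
    refine this.trans ?_
    rw [iidMean_add, iidMean_const hp1, iidMean_const_mul, iidMean_const_mul]
    linarith
  nlinarith

end iidMean

/-! ### Moments of the exchange observable in a product state. -/

/-- The tensor product of a family of matrices, in the product basis. -/
def piMat {κ ι : Type*} [Fintype κ] (A : κ → Matrix ι ι ℂ) : Matrix (κ → ι) (κ → ι) ℂ :=
  Matrix.of fun x y => ∏ t, A t (x t) (y t)

theorem tensorPowMat_eq_piMat {ι : Type*} (A : Matrix ι ι ℂ) (n : ℕ) :
    tensorPowMat A n = piMat fun _ => A := rfl

theorem piMat_mul {κ ι : Type*} [Fintype κ] [DecidableEq κ] [Fintype ι]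
    (A B : κ → Matrix ι ι ℂ) : piMat A * piMat B = piMat fun t => A t * B t := by
  ext x y
  simp only [piMat, Matrix.mul_apply, Matrix.of_apply, Fintype.prod_sum,
    ← Finset.prod_mul_distrib]

theorem trace_piMat {κ ι : Type*} [Fintype κ] [DecidableEq κ] [Fintype ι]
    (A : κ → Matrix ι ι ℂ) : (piMat A).trace = ∏ t, (A t).trace := by
  simp only [Matrix.trace, Matrix.diag_apply, piMat, Matrix.of_apply, Fintype.prod_sum]

theorem piMat_conjTranspose {κ ι : Type*} [Fintype κ] (A : κ → Matrix ι ι ℂ) :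
    (piMat A)ᴴ = piMat fun t => (A t)ᴴ := by
  ext x y
  simp only [piMat, Matrix.conjTranspose_apply, Matrix.of_apply, star_prod]

/-- The matrix `E` acting on the tensor factor `a`. -/
def siteMat {κ ι : Type*} [Fintype κ] [DecidableEq κ] [DecidableEq ι] (a : κ)
    (E : Matrix ι ι ℂ) : Matrix (κ → ι) (κ → ι) ℂ :=
  piMat fun t => if t = a then E else 1

section moments

variable {κ ι : Type*} [Fintype κ] [DecidableEq κ] [Fintype ι] [DecidableEq ι]

theorem trace_piMat_mul_siteMat {ρ : Matrix ι ι ℂ} (hρ : ρ.trace = 1) (a : κ)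
    (E : Matrix ι ι ℂ) : (piMat (fun _ => ρ) * siteMat a E).trace = (ρ * E).trace := by
  rw [siteMat, piMat_mul, trace_piMat, Finset.prod_eq_single a]
  · simp
  · intro b _ hb
    simp [hb, hρ]
  · simp

theorem trace_piMat_mul_siteMat_mul_siteMat {ρ : Matrix ι ι ℂ} (hρ : ρ.trace = 1) (a b : κ)
    (E F : Matrix ι ι ℂ) :
    (piMat (fun _ => ρ) * siteMat a E * siteMat b F).trace =
      if a = b then (ρ * E * F).trace else (ρ * E).trace * (ρ * F).trace := by
  rw [siteMat, siteMat, piMat_mul, piMat_mul, trace_piMat]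
  split_ifs with h
  · subst h
    rw [Finset.prod_eq_single a]
    · simp
    · intro b _ hb
      simp [hb, hρ]
    · simp
  · rw [Finset.prod_eq_mul a b h]
    · simp [h, Ne.symm h]
    · intro c _ hc
      simp [hc.1, hc.2, hρ]
    · simp
    · simp

/-- The average over all tensor factors of the matrix unit `|i⟩⟨j|`. -/
noncomputable def avgUnit (κ : Type*) {ι : Type*} [Fintype κ] [DecidableEq κ] [DecidableEq ι]
    (i j : ι) : Matrix (κ → ι) (κ → ι) ℂ :=
  (Fintype.card κ : ℂ)⁻¹ • ∑ a, siteMat a (Matrix.single i j 1)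

theorem avgUnit_conjTranspose {κ ι : Type*} [Fintype κ] [DecidableEq κ] [DecidableEq ι]
    (i j : ι) : (avgUnit κ i j)ᴴ = avgUnit κ j i := by
  simp only [avgUnit, Matrix.conjTranspose_smul, Matrix.conjTranspose_sum, siteMat,
    piMat_conjTranspose]
  congr 1
  · simp
  · refine Finset.sum_congr rfl fun a _ => ?_
    congr 1
    ext1 t
    split_ifs <;> simp

theorem trace_mul_avgUnit [Nonempty κ] {ρ : Matrix ι ι ℂ} (hρ : ρ.trace = 1) (i j : ι) :
    (piMat (fun _ : κ => ρ) * avgUnit κ i j).trace = ρ j i := by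
  simp only [avgUnit, Matrix.mul_smul, Matrix.mul_sum, Matrix.trace_smul, Matrix.trace_sum,
    trace_piMat_mul_siteMat hρ, Matrix.trace_mul_single]
  simp

/-- Two uniformly chosen sites coincide with probability 1/|κ|, where the matrix units multiply;
otherwise they are independent and the expectations multiply. -/
theorem trace_mul_avgUnit_mul_avgUnit [Nonempty κ] {ρ : Matrix ι ι ℂ} (hρ : ρ.trace = 1)
    (i j k l : ι) :
    (piMat (fun _ : κ => ρ) * avgUnit κ i j * avgUnit κ k l).trace =
      (1 - (Fintype.card κ : ℂ)⁻¹) * (ρ j i * ρ l k) +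
        (Fintype.card κ : ℂ)⁻¹ * (if j = k then ρ l i else 0) := by
  have hK : (Fintype.card κ : ℂ) ≠ 0 := Nat.cast_ne_zero.mpr Fintype.card_ne_zero
  have h1 : (ρ * Matrix.single i j 1 * Matrix.single k l 1).trace = if j = k then ρ l i else 0 := by
    split_ifs with h
    · subst h
      rw [Matrix.mul_assoc, Matrix.single_mul_single_same, Matrix.trace_mul_single]
      simp
    · rw [Matrix.mul_assoc, Matrix.single_mul_single_of_ne _ _ _ _ h]
      simp
  have h2 : ∀ a : κ, ∑ b : κ, (if a = b then (if j = k then ρ l i else 0) else ρ j i * ρ l k) =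
      (if j = k then ρ l i else 0) + ((Fintype.card κ : ℂ) - 1) * (ρ j i * ρ l k) := by
    intro a
    have : ∀ b : κ, (if a = b then (if j = k then ρ l i else 0) else ρ j i * ρ l k) =
        (if a = b then (if j = k then ρ l i else 0) - ρ j i * ρ l k else 0) + ρ j i * ρ l k := by
      intro b
      split_ifs <;> ring
    simp only [this, Finset.sum_add_distrib, Finset.sum_ite_eq, Finset.mem_univ, if_true,
      Finset.sum_const, Finset.card_univ, nsmul_eq_mul]
    ring
  have h3 : (piMat (fun _ : κ => ρ) * avgUnit κ i j * avgUnit κ k l).trace =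
      (Fintype.card κ : ℂ)⁻¹ * ((Fintype.card κ : ℂ)⁻¹ * ∑ a : κ, ∑ b : κ,
        (if a = b then (if j = k then ρ l i else 0) else ρ j i * ρ l k)) := by
    simp only [avgUnit, Matrix.mul_smul, Matrix.smul_mul, Matrix.mul_sum, Matrix.sum_mul,
      Matrix.trace_smul, Matrix.trace_sum, smul_eq_mul,
      trace_piMat_mul_siteMat_mul_siteMat hρ, h1]
    rw [Finset.sum_comm]
    simp [Matrix.trace_mul_single, Finset.mul_sum]
  rw [h3, Finset.sum_congr rfl fun a _ => h2 a, Finset.sum_const, Finset.card_univ, nsmul_eq_mul]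
  field_simp
  ring

/-- The weighted exchange observable between two blocks of tensor factors. -/
noncomputable def exchangeObs (κ : Type*) {ι : Type*} [Fintype κ] [DecidableEq κ] [Fintype ι]
    [DecidableEq ι] (w : ι → ι → ℝ) : Matrix ((κ → ι) × (κ → ι)) ((κ → ι) × (κ → ι)) ℂ :=
  ∑ i, ∑ j, (w i j : ℂ) • (avgUnit κ i j ⊗ₖ avgUnit κ j i)

theorem exchangeObs_isHermitian {w : ι → ι → ℝ} (hw : ∀ i j, w i j = w j i) :
    (exchangeObs κ w).IsHermitian := by
  rw [Matrix.IsHermitian, exchangeObs]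
  simp only [Matrix.conjTranspose_sum, Matrix.conjTranspose_smul,
    Matrix.conjTranspose_kronecker, avgUnit_conjTranspose]
  rw [Finset.sum_comm]
  refine Finset.sum_congr rfl fun i _ => Finset.sum_congr rfl fun j _ => ?_
  simp [hw i j]

/-- Using two separate blocks makes the estimator unbiased: their expectations multiply to ρ_ji ρ_ij
= |ρ_ij|², with no collision term. -/
theorem trace_mul_exchangeObs [Nonempty κ] {ρ : Matrix ι ι ℂ} (hρ : ρ.trace = 1)
    (hh : ρ.IsHermitian) (w : ι → ι → ℝ) :
    ((piMat (fun _ : κ => ρ) ⊗ₖ piMat (fun _ : κ => ρ)) * exchangeObs κ w).trace =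
      ((∑ i, ∑ j, w i j * ‖ρ i j‖ ^ 2 : ℝ) : ℂ) := by
  simp only [exchangeObs, Matrix.mul_sum, Matrix.mul_smul, Matrix.trace_sum, Matrix.trace_smul,
    ← Matrix.mul_kronecker_mul, Matrix.trace_kronecker, trace_mul_avgUnit hρ]
  push_cast
  refine Finset.sum_congr rfl fun i _ => Finset.sum_congr rfl fun j _ => ?_
  rw [← hh.apply j i, Complex.star_def, Complex.conj_mul', smul_eq_mul]

/-- With ρ = B*B the left side is the squared Frobenius norm of BA; Cauchy–Schwarz in each entry
costs the dimension factor and leaves only the diagonal of `ρ`. -/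
theorem re_trace_mul_mul_le {ρ A : Matrix ι ι ℂ} (hρ : ρ.PosSemidef) (hA : A.IsHermitian) :
    (A * A * ρ).trace.re ≤ Fintype.card ι * ∑ i, ∑ j, (ρ i i).re * ‖A i j‖ ^ 2 := by
  obtain ⟨B, hB⟩ := CStarAlgebra.nonneg_iff_eq_star_mul_self.mp hρ.nonneg
  rw [Matrix.star_eq_conjTranspose] at hB
  have hdiag : ∀ i, (ρ i i).re = ∑ t, ‖B t i‖ ^ 2 := by
    intro i
    rw [hB, Matrix.mul_apply, Complex.re_sum]
    refine Finset.sum_congr rfl fun t _ => ?_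
    rw [Matrix.conjTranspose_apply, Complex.star_def, Complex.conj_mul', ← Complex.ofReal_pow,
      Complex.ofReal_re]
  have h1 : (A * A * ρ).trace = ((B * A)ᴴ * (B * A)).trace := by
    rw [hB, Matrix.conjTranspose_mul, hA.eq, Matrix.trace_mul_comm, Matrix.mul_assoc,
      Matrix.trace_mul_comm, Matrix.trace_mul_comm (A * Bᴴ)]
    simp only [Matrix.mul_assoc]
  have h2 : (A * A * ρ).trace.re = ∑ j, ∑ t, ‖∑ i, B t i * A i j‖ ^ 2 := by
    rw [h1, Matrix.trace, Complex.re_sum]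
    refine Finset.sum_congr rfl fun j _ => ?_
    rw [Matrix.diag_apply, Matrix.mul_apply, Complex.re_sum]
    refine Finset.sum_congr rfl fun t _ => ?_
    rw [Matrix.conjTranspose_apply, Complex.star_def, Complex.conj_mul', ← Complex.ofReal_pow,
      Complex.ofReal_re, Matrix.mul_apply]
  have h3 : ∀ j t, ‖∑ i, B t i * A i j‖ ^ 2 ≤
      Fintype.card ι * ∑ i, ‖B t i‖ ^ 2 * ‖A i j‖ ^ 2 := by
    intro j t
    calc ‖∑ i, B t i * A i j‖ ^ 2 ≤ (∑ i, ‖B t i * A i j‖) ^ 2 := by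
          gcongr
          exact norm_sum_le _ _
      _ ≤ Fintype.card ι * ∑ i, ‖B t i * A i j‖ ^ 2 := by
          simpa using sq_sum_le_card_mul_sum_sq (s := Finset.univ)
            (f := fun i => ‖B t i * A i j‖)
      _ = _ := by simp only [norm_mul, mul_pow]
  rw [h2]
  refine (Finset.sum_le_sum fun j _ => Finset.sum_le_sum fun t _ => h3 j t).trans_eq ?_
  simp only [← Finset.mul_sum, hdiag, Finset.sum_mul]
  congr 1
  calc ∑ j, ∑ t, ∑ i, ‖B t i‖ ^ 2 * ‖A i j‖ ^ 2
      = ∑ j, ∑ i, ∑ t, ‖B t i‖ ^ 2 * ‖A i j‖ ^ 2 :=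
        Finset.sum_congr rfl fun j _ => Finset.sum_comm
    _ = _ := Finset.sum_comm

/-- The three terms correspond to a site collision in neither block, in exactly one of the two, and
in both. -/
theorem trace_mul_exchangeObs_mul_exchangeObs [Nonempty κ] {ρ : Matrix ι ι ℂ}
    (hρ : ρ.trace = 1) {w : ι → ι → ℝ} (hw : ∀ i j, w i j = w j i) {A : Matrix ι ι ℂ}
    (hA : A = Matrix.of fun i j => (w i j : ℂ) * ρ i j) :
    ((piMat (fun _ : κ => ρ) ⊗ₖ piMat (fun _ : κ => ρ)) * exchangeObs κ w *
      exchangeObs κ w).trace =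
      (1 - (Fintype.card κ : ℂ)⁻¹) ^ 2 * (∑ i, ∑ j, (w i j : ℂ) * (ρ j i * ρ i j)) ^ 2 +
      2 * (1 - (Fintype.card κ : ℂ)⁻¹) * (Fintype.card κ : ℂ)⁻¹ * (A * A * ρ).trace +
      ((Fintype.card κ : ℂ)⁻¹) ^ 2 * ∑ i, ∑ j, (w i j : ℂ) ^ 2 * (ρ i i * ρ j j) := by
  have hAA : (A * A * ρ).trace = ∑ l, ∑ i, ∑ j, A l j * A j i * ρ i l := by
    simp only [Matrix.trace, Matrix.diag_apply, Matrix.mul_apply, Finset.sum_mul]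
  set β := (Fintype.card κ : ℂ)⁻¹
  have hexp : ((piMat (fun _ : κ => ρ) ⊗ₖ piMat (fun _ : κ => ρ)) * exchangeObs κ w *
      exchangeObs κ w).trace = ∑ k, ∑ l, ∑ i, ∑ j, (w i j : ℂ) * (w k l : ℂ) *
        (((1 - β) * (ρ j i * ρ l k) + β * (if j = k then ρ l i else 0)) *
          ((1 - β) * (ρ i j * ρ k l) + β * (if i = l then ρ k j else 0))) := by
    simp only [exchangeObs, Matrix.mul_sum, Matrix.sum_mul, Matrix.mul_smul, Matrix.smul_mul,
      Matrix.trace_sum, Matrix.trace_smul, ← Matrix.mul_kronecker_mul, Matrix.trace_kronecker,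
      trace_mul_avgUnit_mul_avgUnit hρ, smul_eq_mul]
    refine Finset.sum_congr rfl fun k _ => Finset.sum_congr rfl fun l _ => ?_
    simp only [Finset.mul_sum]
    refine Finset.sum_congr rfl fun i _ => Finset.sum_congr rfl fun j _ => ?_
    ring
  have hterm : ∀ i j k l, (w i j : ℂ) * (w k l : ℂ) *
        (((1 - β) * (ρ j i * ρ l k) + β * (if j = k then ρ l i else 0)) *
          ((1 - β) * (ρ i j * ρ k l) + β * (if i = l then ρ k j else 0))) =
      (1 - β) ^ 2 * (((w i j : ℂ) * (ρ j i * ρ i j)) * ((w k l : ℂ) * (ρ l k * ρ k l))) +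
      ((1 - β) * β * (if j = k then A i j * A k l * ρ l i else 0) +
      ((1 - β) * β * (if i = l then A j i * A l k * ρ k j else 0) +
      β ^ 2 * (if j = k then if i = l then (w i j : ℂ) ^ 2 * (ρ i i * ρ j j) else 0 else 0))) := by
    intro i j k l
    rw [hA]
    simp only [Matrix.of_apply]
    split_ifs with h1 h2 h2
    · subst h1 h2
      rw [hw j i]
      ring1
    · ring
    · subst h2
      rw [hw j i, hw k i]
      ring
    · ring
  have e1 : ∑ k, ∑ l, ∑ i, A i k * A k l * ρ l i = (A * A * ρ).trace := by
    rw [hAA]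
    calc _ = ∑ k, ∑ i, ∑ l, A i k * A k l * ρ l i :=
          Finset.sum_congr rfl fun k _ => Finset.sum_comm
      _ = ∑ i, ∑ k, ∑ l, A i k * A k l * ρ l i := Finset.sum_comm
      _ = _ := Finset.sum_congr rfl fun i _ => Finset.sum_comm
  have e2 : ∑ k, ∑ l, ∑ j, A j l * A l k * ρ k j = (A * A * ρ).trace := by
    rw [hAA]
    calc _ = ∑ k, ∑ j, ∑ l, A j l * A l k * ρ k j :=
          Finset.sum_congr rfl fun k _ => Finset.sum_comm
      _ = _ := Finset.sum_comm
  have e3 : ∑ k, ∑ l, (w l k : ℂ) ^ 2 * (ρ l l * ρ k k) =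
      ∑ i, ∑ j, (w i j : ℂ) ^ 2 * (ρ i i * ρ j j) := Finset.sum_comm
  rw [hexp]
  simp only [hterm, Finset.sum_add_distrib, ← Finset.mul_sum, Finset.sum_ite_eq', Finset.sum_ite_irrel,
    Finset.sum_const_zero, Finset.mem_univ, if_true, ← Finset.sum_mul, e1, e2, e3]
  ring

/-- The second moment of the exchange observable in a product state. -/
theorem re_trace_mul_exchangeObs_sq_le [Nonempty κ] {ρ : Matrix ι ι ℂ} (hρ : ρ.trace = 1)
    (hp : ρ.PosSemidef) {w : ι → ι → ℝ} (hw : ∀ i j, w i j = w j i) :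
    ((piMat (fun _ : κ => ρ) ⊗ₖ piMat (fun _ : κ => ρ)) *
      (exchangeObs κ w * exchangeObs κ w)).trace.re ≤
      (∑ i, ∑ j, w i j * ‖ρ i j‖ ^ 2) ^ 2 +
      2 / Fintype.card κ *
        (Fintype.card ι * ∑ i, ∑ j, (ρ i i).re * (w i j ^ 2 * ‖ρ i j‖ ^ 2)) +
      1 / (Fintype.card κ : ℝ) ^ 2 * ∑ i, ∑ j, w i j ^ 2 * ((ρ i i).re * (ρ j j).re) := by
  have hh := hp.isHermitian
  set A : Matrix ι ι ℂ := Matrix.of fun i j => (w i j : ℂ) * ρ i j with hA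
  have hAh : A.IsHermitian := by
    ext i j
    rw [Matrix.conjTranspose_apply, hA, Matrix.of_apply, Matrix.of_apply, star_mul',
      hh.apply, hw j i]
    simp
  have hdiag : ∀ i, ρ i i = ((ρ i i).re : ℂ) := fun i => (hh.coe_re_apply_self i).symm
  have e1 : ∑ i, ∑ j, (w i j : ℂ) * (ρ j i * ρ i j) =
      ((∑ i, ∑ j, w i j * ‖ρ i j‖ ^ 2 : ℝ) : ℂ) := by
    push_cast
    refine Finset.sum_congr rfl fun i _ => Finset.sum_congr rfl fun j _ => ?_
    rw [← hh.apply j i, Complex.star_def, Complex.conj_mul']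
  have e2 : ∑ i, ∑ j, (w i j : ℂ) ^ 2 * (ρ i i * ρ j j) =
      ((∑ i, ∑ j, w i j ^ 2 * ((ρ i i).re * (ρ j j).re) : ℝ) : ℂ) := by
    push_cast
    refine Finset.sum_congr rfl fun i _ => Finset.sum_congr rfl fun j _ => ?_
    rw [← hdiag, ← hdiag]
  have hG : (A * A * ρ).trace.re ≤
      Fintype.card ι * ∑ i, ∑ j, (ρ i i).re * (w i j ^ 2 * ‖ρ i j‖ ^ 2) := by
    refine (re_trace_mul_mul_le hp hAh).trans_eq ?_
    simp only [hA, Matrix.of_apply, norm_mul, mul_pow, Complex.norm_real, Real.norm_eq_abs,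
      sq_abs]
  rw [← Matrix.mul_assoc, trace_mul_exchangeObs_mul_exchangeObs hρ hw hA, e1, e2]
  set G := (A * A * ρ).trace
  set b : ℝ := (Fintype.card κ : ℝ)⁻¹ with hb
  have hK : (1 : ℝ) ≤ Fintype.card κ := Nat.one_le_cast.mpr Fintype.card_pos
  have hb0 : 0 ≤ b := by positivity
  have hb1 : b ≤ 1 := inv_le_one_of_one_le₀ hK
  have hbc : (Fintype.card κ : ℂ)⁻¹ = (b : ℂ) := by rw [hb]; push_cast; rfl
  have hV : 0 ≤ Fintype.card ι * ∑ i, ∑ j, (ρ i i).re * (w i j ^ 2 * ‖ρ i j‖ ^ 2) := by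
    refine mul_nonneg (Nat.cast_nonneg _) (Finset.sum_nonneg fun i _ => Finset.sum_nonneg
      fun j _ => mul_nonneg ?_ (by positivity))
    exact (Complex.nonneg_iff.mp hp.diag_nonneg).1
  set δ := ∑ i, ∑ j, w i j * ‖ρ i j‖ ^ 2
  set V := Fintype.card ι * ∑ i, ∑ j, (ρ i i).re * (w i j ^ 2 * ‖ρ i j‖ ^ 2)
  set W := ∑ i, ∑ j, w i j ^ 2 * ((ρ i i).re * (ρ j j).re)
  have e : ((1 - (Fintype.card κ : ℂ)⁻¹) ^ 2 * (δ : ℂ) ^ 2 +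
      2 * (1 - (Fintype.card κ : ℂ)⁻¹) * (Fintype.card κ : ℂ)⁻¹ * G +
      ((Fintype.card κ : ℂ)⁻¹) ^ 2 * (W : ℂ)).re =
      (1 - b) ^ 2 * δ ^ 2 + 2 * (1 - b) * b * G.re + b ^ 2 * W := by
    rw [hbc]
    have : (1 - (b : ℂ)) ^ 2 * (δ : ℂ) ^ 2 + 2 * (1 - b) * b * G + (b : ℂ) ^ 2 * (W : ℂ) =
        (((1 - b) ^ 2 * δ ^ 2 + b ^ 2 * W : ℝ) : ℂ) + ((2 * (1 - b) * b : ℝ) : ℂ) * G := by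
      push_cast
      ring
    rw [this, Complex.add_re, Complex.ofReal_re, Complex.re_ofReal_mul]
    ring
  rw [e]
  have t1 : (1 - b) ^ 2 * δ ^ 2 ≤ δ ^ 2 := by
    refine mul_le_of_le_one_left (sq_nonneg _) ?_
    nlinarith
  have t2 : 2 * (1 - b) * b * G.re ≤ 2 * b * V := by
    have h1 : 2 * (1 - b) * b * G.re ≤ 2 * (1 - b) * b * V :=
      mul_le_mul_of_nonneg_left hG (by nlinarith)
    nlinarith [mul_nonneg (mul_nonneg hb0 hb0) hV]
  have e4 : 2 / (Fintype.card κ : ℝ) = 2 * b := by rw [hb]; ring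
  have e5 : 1 / (Fintype.card κ : ℝ) ^ 2 = b ^ 2 := by rw [hb]; ring
  rw [e4, e5]
  linarith

end moments

/-! ### Chebyshev inequalities for spectral projections. -/

section threshold

variable {ι : Type*} [Fintype ι] [DecidableEq ι]

theorem re_trace_mul_nonneg {R A : Matrix ι ι ℂ} (hR : R.PosSemidef) (hA : A.PosSemidef) :
    0 ≤ (R * A).trace.re := by
  obtain ⟨B, hB⟩ := CStarAlgebra.nonneg_iff_eq_star_mul_self.mp hR.nonneg
  rw [Matrix.star_eq_conjTranspose] at hB
  rw [hB, Matrix.mul_assoc, Matrix.trace_mul_comm]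
  exact (Complex.nonneg_iff.mp (hA.mul_mul_conjTranspose_same B).trace_nonneg).1

theorem re_trace_mul_mono {R A B : Matrix ι ι ℂ} (hR : R.PosSemidef) (h : A ≤ B) :
    (R * A).trace.re ≤ (R * B).trace.re := by
  have := re_trace_mul_nonneg hR (Matrix.le_iff.mp h)
  rw [Matrix.mul_sub, Matrix.trace_sub, Complex.sub_re] at this
  linarith

/-- The spectral projection of `Z` onto `[τ, ∞)`. -/
noncomputable def thresholdProj (Z : Matrix ι ι ℂ) (τ : ℝ) : Matrix ι ι ℂ :=
  cfc (fun z : ℝ => if τ ≤ z then (1 : ℝ) else 0) Z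

theorem Matrix.continuousOn_spectrum (Z : Matrix ι ι ℂ) (f : ℝ → ℝ) :
    ContinuousOn f (spectrum ℝ Z) :=
  (Matrix.finite_real_spectrum (A := Z)).continuousOn f

theorem thresholdProj_posSemidef (Z : Matrix ι ι ℂ) (τ : ℝ) :
    (thresholdProj Z τ).PosSemidef := by
  rw [← Matrix.nonneg_iff_posSemidef]
  refine cfc_nonneg fun z _ => ?_
  split_ifs <;> norm_num

theorem one_sub_thresholdProj_posSemidef (Z : Matrix ι ι ℂ) (τ : ℝ) :
    (1 - thresholdProj Z τ).PosSemidef := by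
  rw [← Matrix.le_iff]
  refine cfc_le_one _ _ fun z _ => ?_
  split_ifs <;> norm_num

/-- The scalar bound 1_{z ≥ τ} ≤ z²/τ² transfers to operators through the functional calculus. -/
theorem re_trace_mul_thresholdProj_le {R Z : Matrix ι ι ℂ} (hR : R.PosSemidef)
    (hZ : Z.IsHermitian) {τ : ℝ} (hτ : 0 < τ) :
    (R * thresholdProj Z τ).trace.re ≤ (R * (Z * Z)).trace.re / τ ^ 2 := by
  have hs : IsSelfAdjoint Z := hZ
  have h1 : thresholdProj Z τ ≤ cfc (fun z : ℝ => (τ ^ 2)⁻¹ * z ^ 2) Z := by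
    refine cfc_mono (fun z _ => ?_) (Z.continuousOn_spectrum _) (Z.continuousOn_spectrum _)
    split_ifs with h
    · rw [inv_mul_eq_div, one_le_div (by positivity)]
      gcongr
    · positivity
  have h2 : cfc (fun z : ℝ => (τ ^ 2)⁻¹ * z ^ 2) Z = (τ ^ 2)⁻¹ • (Z * Z) := by
    rw [cfc_const_mul _ _ _ (Z.continuousOn_spectrum _), cfc_pow_id (R := ℝ) Z 2, pow_two Z]
  refine (re_trace_mul_mono hR (h1.trans_eq h2)).trans_eq ?_
  rw [Matrix.mul_smul, Matrix.trace_smul, Complex.smul_re, smul_eq_mul, inv_mul_eq_div]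

/-- If z < τ ≤ μ/2 then |z - μ| > μ/2, so 1_{z < τ} ≤ 4(z - μ)²/μ². -/
theorem re_trace_mul_one_sub_thresholdProj_le {R Z : Matrix ι ι ℂ} (hR : R.PosSemidef)
    (hR1 : R.trace = 1) (hZ : Z.IsHermitian) {τ μ : ℝ} (hτ : 0 < τ) (hμ : 2 * τ ≤ μ) :
    (R * (1 - thresholdProj Z τ)).trace.re ≤
      4 / μ ^ 2 * ((R * (Z * Z)).trace.re - 2 * μ * (R * Z).trace.re + μ ^ 2) := by
  have hs : IsSelfAdjoint Z := hZ
  have hμ0 : 0 < μ := by linarith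
  have h0 : 1 - thresholdProj Z τ =
      cfc (fun z : ℝ => 1 - if τ ≤ z then (1 : ℝ) else 0) Z := by
    rw [cfc_sub _ _ _ (Z.continuousOn_spectrum _) (Z.continuousOn_spectrum _), cfc_const_one ℝ Z,
      thresholdProj]
  have h1 : cfc (fun z : ℝ => 1 - if τ ≤ z then (1 : ℝ) else 0) Z ≤
      cfc (fun z : ℝ => 4 / μ ^ 2 * (z - μ) ^ 2) Z := by
    refine cfc_mono (fun z _ => ?_) (Z.continuousOn_spectrum _) (Z.continuousOn_spectrum _)
    split_ifs with h
    · simp only [sub_self]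
      positivity
    · rw [sub_zero, div_mul_eq_mul_div, one_le_div (by positivity)]
      nlinarith
  have h2 : cfc (fun z : ℝ => 4 / μ ^ 2 * (z - μ) ^ 2) Z =
      (4 / μ ^ 2) • (Z * Z - (2 * μ) • Z + (μ ^ 2) • (1 : Matrix ι ι ℂ)) := by
    have e : cfc (fun z : ℝ => z - μ) Z = Z - μ • (1 : Matrix ι ι ℂ) := by
      rw [cfc_sub _ _ _ (Z.continuousOn_spectrum _) (Z.continuousOn_spectrum _), cfc_id' ℝ Z,
        cfc_const μ Z, Algebra.algebraMap_eq_smul_one]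
    rw [cfc_const_mul _ _ _ (Z.continuousOn_spectrum _),
      cfc_pow _ _ _ (Z.continuousOn_spectrum _), e]
    congr 1
    rw [pow_two, Matrix.sub_mul, Matrix.mul_sub, Matrix.mul_sub, Matrix.mul_smul, Matrix.smul_mul,
      Matrix.smul_mul, Matrix.mul_smul, Matrix.mul_one, Matrix.one_mul, Matrix.mul_one, smul_smul]
    module
  rw [h0]
  refine (re_trace_mul_mono hR (h1.trans_eq h2)).trans_eq ?_
  simp only [Matrix.mul_smul, Matrix.trace_smul, Complex.smul_re, smul_eq_mul, Matrix.mul_add,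
    Matrix.mul_sub, Matrix.trace_add, Matrix.trace_sub, Complex.add_re, Complex.sub_re,
    hR1, Complex.one_re, mul_one]

/-- The projective measurement of `Z` against the threshold `τ`; the outcome `false` reports a
value at least `τ`. -/
noncomputable def thresholdPOVM (Z : Matrix ι ι ℂ) (τ : ℝ) : POVM ι Bool where
  effect b := bif b then 1 - thresholdProj Z τ else thresholdProj Z τ
  posSemidef b := by
    cases b
    · exact thresholdProj_posSemidef Z τ
    · exact one_sub_thresholdProj_posSemidef Z τ
  sum_eq_one := by simp

end threshold

/-! ### Measurements that depend on an earlier outcome. -/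

section adaptive

theorem Matrix.PosSemidef.blockDiagonal {ι o : Type*} [Fintype ι] [Fintype o] [DecidableEq o]
    {Q : o → Matrix ι ι ℂ} (hQ : ∀ x, (Q x).PosSemidef) :
    (Matrix.blockDiagonal Q).PosSemidef := by
  classical
  choose B hB using fun x => CStarAlgebra.nonneg_iff_eq_star_mul_self.mp (hQ x).nonneg
  have : Matrix.blockDiagonal Q = (Matrix.blockDiagonal B)ᴴ * Matrix.blockDiagonal B := by
    rw [Matrix.blockDiagonal_conjTranspose, ← Matrix.blockDiagonal_mul]
    congr 1
    ext1 x
    exact hB x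
  rw [this]
  exact Matrix.posSemidef_conjTranspose_mul_self _

/-- Relabel the basis of a measured space. -/
def POVM.reindex {ι ι' κ : Type*} [Fintype ι] [DecidableEq ι] [Fintype ι'] [DecidableEq ι']
    [Fintype κ] (M : POVM ι κ) (e : ι' ≃ ι) : POVM ι' κ where
  effect b := (M.effect b).submatrix e e
  posSemidef b := (M.posSemidef b).submatrix e
  sum_eq_one := by
    have : ∑ b, (M.effect b).submatrix e e = (∑ b, M.effect b).submatrix e e := by
      ext x y
      simp [Matrix.sum_apply]
    rw [this, M.sum_eq_one, Matrix.submatrix_one_equiv]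

/-- Measure the second factor in its basis, then apply to the first factor the measurement
selected by the outcome. -/
def POVM.adaptive {ι o κ : Type*} [Fintype ι] [DecidableEq ι] [Fintype o] [DecidableEq o]
    [Fintype κ] (Q : o → POVM ι κ) : POVM (ι × o) κ where
  effect b := Matrix.blockDiagonal fun x => (Q x).effect b
  posSemidef b := Matrix.PosSemidef.blockDiagonal fun x => (Q x).posSemidef b
  sum_eq_one := by
    ext ⟨i, x⟩ ⟨j, y⟩
    simp only [Matrix.sum_apply, Matrix.blockDiagonal_apply, Matrix.one_apply, Prod.mk.injEq]
    by_cases h : x = y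
    · subst h
      have := congrFun (congrFun (Q x).sum_eq_one i) j
      simpa [Matrix.sum_apply, Matrix.one_apply] using this
    · simp [h]

theorem trace_kronecker_mul_blockDiagonal {ι o : Type*} [Fintype ι] [Fintype o]
    [DecidableEq o] (R : Matrix ι ι ℂ) (S : Matrix o o ℂ) (Q : o → Matrix ι ι ℂ) :
    ((R ⊗ₖ S) * Matrix.blockDiagonal Q).trace = ∑ x, S x x * (R * Q x).trace := by
  simp only [Matrix.trace, Matrix.diag_apply, Matrix.mul_apply, Fintype.sum_prod_type,
    Matrix.kroneckerMap_apply, Matrix.blockDiagonal_apply, mul_ite, mul_zero,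
    Finset.sum_ite_eq', Finset.mem_univ, if_true]
  rw [Finset.sum_comm]
  simp only [Finset.mul_sum]
  refine Finset.sum_congr rfl fun x _ => Finset.sum_congr rfl fun i _ =>
    Finset.sum_congr rfl fun j _ => ?_
  ring

theorem Matrix.trace_submatrix_equiv {ι ι' : Type*} [Fintype ι] [Fintype ι']
    (A : Matrix ι ι ℂ) (e : ι' ≃ ι) : (A.submatrix e e).trace = A.trace :=
  e.sum_comp fun i => A i i

/-- Split `2 k + m` tensor factors into two blocks of `k` and one of `m`. -/
def splitCopies (ι : Type*) {n k m : ℕ} (h : k + k + m = n) :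
    (Fin n → ι) ≃ ((Fin k → ι) × (Fin k → ι)) × (Fin m → ι) :=
  (Equiv.arrowCongr ((finCongr h.symm).trans ((finSumFinEquiv (m := k + k) (n := m)).symm.trans
    (Equiv.sumCongr finSumFinEquiv.symm (Equiv.refl _)))) (Equiv.refl ι)).trans
    ((Equiv.sumArrowEquivProdArrow _ _ ι).trans
      ((Equiv.sumArrowEquivProdArrow _ _ ι).prodCongr (Equiv.refl _)))

theorem tensorPowMat_eq_submatrix {ι : Type*} (A : Matrix ι ι ℂ) {n k m : ℕ}
    (h : k + k + m = n) :
    tensorPowMat A n = ((tensorPowMat A k ⊗ₖ tensorPowMat A k) ⊗ₖ tensorPowMat A m).submatrix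
      (splitCopies ι h) (splitCopies ι h) := by
  subst h
  ext x y
  simp only [tensorPowMat, Matrix.of_apply, Matrix.submatrix_apply, Matrix.kroneckerMap_apply,
    Fin.prod_univ_add]
  rfl

/-- The diagonal entries of ρ^{⊗m} are products of diagonal entries of `ρ`, so the measured block is
a classical i.i.d. sample and the analysis reduces to `iidMean`. -/
theorem prob_reindex_adaptive {ι κ : Type*} [Fintype ι] [DecidableEq ι] [Fintype κ]
    (ρ : QState ι) {n k m : ℕ} (h : k + k + m = n)
    (Q : (Fin m → ι) → POVM ((Fin k → ι) × (Fin k → ι)) κ) (b : κ) :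
    ((POVM.adaptive Q).reindex (splitCopies ι h)).prob (ρ.copies n) b =
      iidMean (fun i => (ρ.mat i i).re) m fun x =>
        ((tensorPowMat ρ.mat k ⊗ₖ tensorPowMat ρ.mat k) * (Q x).effect b).trace.re := by
  have h1 : (ρ.copies n).mat = tensorPowMat ρ.mat n := rfl
  rw [POVM.prob, h1, tensorPowMat_eq_submatrix ρ.mat h, POVM.reindex,
    Matrix.submatrix_mul_equiv, Matrix.trace_submatrix_equiv, POVM.adaptive,
    trace_kronecker_mul_blockDiagonal, iidMean, Complex.re_sum]
  refine Finset.sum_congr rfl fun x _ => ?_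
  have : tensorPowMat ρ.mat m x x = ((∏ t, (ρ.mat (x t) (x t)).re : ℝ) : ℂ) := by
    rw [tensorPowMat, Matrix.of_apply]
    push_cast
    exact Finset.prod_congr rfl fun t _ =>
      (ρ.posSemidef.isHermitian.coe_re_apply_self (x t)).symm
  rw [this, Complex.re_ofReal_mul]

end adaptive

/-! ### Empirical weights and their comparison with the true ones. -/

section weights

/-- The indicator of the pair `{i, j}`. -/
def pairInd {ι : Type*} [DecidableEq ι] (i j a : ι) : ℕ := if a = i ∨ a = j then 1 else 0

/-- The inverse of the smoothed empirical frequency of `{i, j}` in the sample `x`. -/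
noncomputable def invFreq {ι : Type*} [DecidableEq ι] {m : ℕ} (x : Fin m → ι) (i j : ι) : ℝ :=
  if i = j then 0 else m / ((hits (pairInd i j) x : ℝ) + 2)

theorem pairInd_le_one {ι : Type*} [DecidableEq ι] (i j a : ι) : pairInd i j a ≤ 1 := by
  unfold pairInd
  split_ifs <;> simp

theorem invFreq_comm {ι : Type*} [DecidableEq ι] {m : ℕ} (x : Fin m → ι) (i j : ι) :
    invFreq x i j = invFreq x j i := by
  have : pairInd i j = pairInd j i := by
    ext a
    simp only [pairInd, or_comm]
  simp only [invFreq, this, eq_comm (a := i)]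

theorem invFreq_nonneg {ι : Type*} [DecidableEq ι] {m : ℕ} (x : Fin m → ι) (i j : ι) :
    0 ≤ invFreq x i j := by
  unfold invFreq
  split_ifs <;> positivity

variable {ι : Type*} [Fintype ι] [DecidableEq ι] {r : ι → ℝ} {m : ℕ}

theorem sum_mul_pairInd {i j : ι} (h : i ≠ j) : ∑ a, r a * pairInd i j a = r i + r j := by
  have : ∀ a, r a * (pairInd i j a : ℝ) = (if a = i then r a else 0) + if a = j then r a else 0 := by
    intro a
    unfold pairInd
    by_cases h1 : a = i
    · subst h1
      simp [h]
    · by_cases h2 : a = j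
      · subst h2
        simp [h1]
      · simp [h1, h2]
  simp [this, Finset.sum_add_distrib]

/-- Combine the second inverse moment with 4 r_i r_j ≤ (r_i + r_j)². -/
theorem iidMean_invFreq_sq_mul_le (hr : ∀ i, 0 ≤ r i) (hr1 : ∑ i, r i = 1) (i j : ι) :
    iidMean r m (fun x => invFreq x i j ^ 2) * (r i * r j) ≤ 1 / 4 := by
  by_cases h : i = j
  · simp [invFreq, h, iidMean]
  · have := sq_mul_iidMean_inv_hits_le (m := m) hr1 (pairInd_le_one i j) hr
    rw [sum_mul_pairInd h] at this
    simp only [invFreq, if_neg h]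
    have h0 : 0 ≤ iidMean r m (fun x => (m / ((hits (pairInd i j) x : ℝ) + 2)) ^ 2) :=
      Finset.sum_nonneg fun x _ => mul_nonneg (Finset.prod_nonneg fun t _ => hr _) (sq_nonneg _)
    nlinarith [mul_nonneg h0 (sq_nonneg (r i - r j))]

theorem iidMean_invFreq_sq_mul_add_le (hr : ∀ i, 0 ≤ r i) (hr1 : ∑ i, r i = 1) (hm : 0 < m)
    (i j : ι) :
    iidMean r m (fun x => invFreq x i j ^ 2) * (r i + r j) ≤
      if i = j then 0 else 2 / (r i + r j + 2 / m) := by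
  by_cases h : i = j
  · simp [invFreq, h, iidMean]
  · have := mul_iidMean_inv_hits_le hr1 (pairInd_le_one i j) hr hm
    rw [sum_mul_pairInd h] at this
    simp only [invFreq, if_neg h]
    linarith

theorem iidMean_freq (hr1 : ∑ i, r i = 1) (hm : 0 < m) {i j : ι} (h : i ≠ j) :
    iidMean r m (fun x => ((hits (pairInd i j) x : ℝ) + 2) / m) = r i + r j + 2 / m := by
  have e : (fun x : Fin m → ι => ((hits (pairInd i j) x : ℝ) + 2) / m) =
      fun x => (m : ℝ)⁻¹ * (hits (pairInd i j) x : ℝ) + 2 / m := by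
    ext x
    ring
  have hm' : (m : ℝ) ≠ 0 := by positivity
  rw [e, iidMean_add, iidMean_const_mul, iidMean_hits hr1 (pairInd_le_one i j),
    iidMean_const hr1, sum_mul_pairInd h, inv_mul_cancel_left₀ hm']

/-- The off-diagonal part of the regularised Bures `χ²`-divergence from the diagonal. -/
noncomputable def offDiagChiSq (m : ℕ) (r : ι → ℝ) (a : ι → ι → ℝ) : ℝ :=
  ∑ i, ∑ j, if i = j then 0 else a i j / (r i + r j + 2 / m)

/-- The ratio of true to empirical frequencies, averaged against the terms of `offDiagChiSq`. -/
noncomputable def chiSqDistortion (r : ι → ℝ) (a : ι → ι → ℝ) (x : Fin m → ι) : ℝ :=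
  ∑ i, ∑ j, if i = j then 0 else
    a i j / (r i + r j + 2 / m) ^ 2 * (((hits (pairInd i j) x : ℝ) + 2) / m)

theorem iidMean_chiSqDistortion (hr : ∀ i, 0 ≤ r i) (hr1 : ∑ i, r i = 1) (hm : 0 < m)
    (a : ι → ι → ℝ) : iidMean r m (chiSqDistortion r a) = offDiagChiSq m r a := by
  unfold chiSqDistortion
  rw [iidMean_sum]
  refine Finset.sum_congr rfl fun i _ => ?_
  rw [iidMean_sum]
  refine Finset.sum_congr rfl fun j _ => ?_
  by_cases h : i = j
  · simp [h, iidMean]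
  · have hi := hr i
    have hj := hr j
    have hm' : (0 : ℝ) < m := Nat.cast_pos.mpr hm
    have hp : r i + r j + 2 / m ≠ 0 := by positivity
    simp only [if_neg h]
    rw [iidMean_const_mul, iidMean_freq hr1 hm h]
    field_simp

/-- With p the regularised true frequency and q the empirical one, a/p is the geometric mean of a/q
and aq/p², so this is Cauchy–Schwarz. As q has mean p, the second factor averages to `offDiagChiSq`,
so the empirically weighted sum is seldom small. -/
theorem offDiagChiSq_sq_le (hr : ∀ i, 0 ≤ r i) (hm : 0 < m) {a : ι → ι → ℝ}
    (ha : ∀ i j, 0 ≤ a i j) (x : Fin m → ι) :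
    offDiagChiSq m r a ^ 2 ≤ (∑ i, ∑ j, invFreq x i j * a i j) * chiSqDistortion r a x := by
  have hm' : (0 : ℝ) < m := Nat.cast_pos.mpr hm
  have h0 : ∀ i j, 0 < r i + r j + 2 / m := fun i j => by
    have hi := hr i
    have hj := hr j
    positivity
  unfold offDiagChiSq chiSqDistortion
  simp only [← Fintype.sum_prod_type']
  refine Finset.sum_sq_le_sum_mul_sum_of_sq_le_mul _ ?_ ?_ ?_
  · rintro ⟨i, j⟩ _
    exact mul_nonneg (invFreq_nonneg x i j) (ha i j)
  · rintro ⟨i, j⟩ _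
    dsimp only
    split_ifs
    · exact le_rfl
    · have := ha i j
      positivity
  · rintro ⟨i, j⟩ _
    refine le_of_eq ?_
    dsimp only
    unfold invFreq
    split_ifs
    · simp
    · have := h0 i j
      have : (0 : ℝ) < hits (pairInd i j) x + 2 := by positivity
      field_simp

end weights

/-! ### A diagonal state close to `ρ`. -/

section fidelity

variable {ι : Type*} [Fintype ι] [DecidableEq ι]

theorem QState.re_diag_nonneg {ι : Type*} [Fintype ι] (ρ : QState ι) (i : ι) : 0 ≤ (ρ.mat i i).re :=
  (Complex.nonneg_iff.mp ρ.posSemidef.diag_nonneg).1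

theorem QState.sum_re_diag {ι : Type*} [Fintype ι] (ρ : QState ι) : ∑ i, (ρ.mat i i).re = 1 := by
  have := congrArg Complex.re ρ.trace_eq_one
  rwa [Matrix.trace, Complex.re_sum] at this

/-- The diagonal state with given weights. -/
noncomputable def QState.ofWeights (s : ι → ℝ) (hs : ∀ i, 0 ≤ s i) (hs1 : ∑ i, s i = 1) :
    QState ι where
  mat := Matrix.diagonal fun i => (s i : ℂ)
  posSemidef := Matrix.PosSemidef.diagonal fun i => by simpa using hs i
  trace_eq_one := by
    rw [Matrix.trace_diagonal]
    exact_mod_cast hs1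

/-- Some diagonal state is as close to `ρ` as the off-diagonal `χ²`-divergence predicts. -/
theorem QState.exists_isDiagonal_infidelity_le (ρ : QState ι) {m : ℕ} (hm : 0 < m) :
    ∃ σ : QState ι, σ.IsDiagonal ∧ ρ.infidelity σ ≤
      (1 + Fintype.card ι / m) *
        offDiagChiSq m (fun i => (ρ.mat i i).re) (fun i j => ‖ρ.mat i j‖ ^ 2) +
      (((Fintype.card ι : ℝ) / m) ^ 2 + Fintype.card ι / m) := by
  set r : ι → ℝ := fun i => (ρ.mat i i).re with hrdef
  have hr : ∀ i, 0 ≤ r i := ρ.re_diag_nonneg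
  have hm' : (0 : ℝ) < m := Nat.cast_pos.mpr hm
  set η : ℝ := Fintype.card ι / m with hη
  have hη0 : 0 ≤ η := by positivity
  have hη1 : 0 < 1 + η := by positivity
  -- Adding 1/m to each entry makes the weights positive and turns s_i + s_j into the regularised
  -- denominator r_i + r_j + 2/m, up to the normalisation 1 + η.
  set s : ι → ℝ := fun i => (r i + 1 / m) / (1 + η) with hsdef
  have hs : ∀ i, 0 < s i := fun i => by
    have := hr i
    simp only [hsdef]
    positivity
  have hs1 : ∑ i, s i = 1 := by
    simp only [hsdef, ← Finset.sum_div, Finset.sum_add_distrib, Finset.sum_const,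
      Finset.card_univ, nsmul_eq_mul]
    rw [show ∑ i, r i = 1 from ρ.sum_re_diag, mul_one, ← hη, div_self hη1.ne']
  refine ⟨QState.ofWeights s (fun i => (hs i).le) hs1, Matrix.isDiag_diagonal _, ?_⟩
  refine (ρ.infidelity_le_chiSq _ hs rfl).trans ?_
  have hterm : ∀ i j, ‖ρ.mat i j - (QState.ofWeights s (fun i => (hs i).le) hs1).mat i j‖ ^ 2 /
      (s i + s j) ≤
      (1 + η) * (if i = j then 0 else ‖ρ.mat i j‖ ^ 2 / (r i + r j + 2 / m)) +
        if i = j then r i * η ^ 2 + 1 / m else 0 := by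
    intro i j
    have hi := hr i
    have hj := hr j
    by_cases h : i = j
    · subst h
      rw [if_pos rfl, if_pos rfl, mul_zero, zero_add]
      have e1 : (QState.ofWeights s (fun i => (hs i).le) hs1).mat i i = (s i : ℂ) :=
        Matrix.diagonal_apply_eq _ _
      have e2 : ρ.mat i i = (r i : ℂ) :=
        (ρ.posSemidef.isHermitian.coe_re_apply_self i).symm
      rw [e1, e2, ← Complex.ofReal_sub, Complex.norm_real, Real.norm_eq_abs, sq_abs,
        div_le_iff₀ (by linarith [hs i])]
      have e3 : r i - s i = (r i * η - 1 / m) / (1 + η) := by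
        simp only [hsdef]
        field_simp
        ring
      have e4 : s i = (r i + 1 / m) / (1 + η) := rfl
      set u : ℝ := 1 / m with hu
      have hu0 : 0 < u := by positivity
      have h1 : (r i * η - u) ^ 2 ≤ (r i * η ^ 2 + u) * (r i + u) := by
        nlinarith [mul_nonneg hi hu0.le, mul_nonneg (mul_nonneg hi hu0.le) hη0,
          mul_nonneg (mul_nonneg hi hu0.le) (sq_nonneg η)]
      rw [e3, div_pow, e4]
      calc (r i * η - u) ^ 2 / (1 + η) ^ 2 ≤ (r i * η ^ 2 + u) * (r i + u) / (1 + η) ^ 2 := by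
            gcongr
        _ ≤ (r i * η ^ 2 + u) * (r i + u) / (1 + η) := by
            gcongr
            nlinarith
        _ = (r i * η ^ 2 + u) * ((r i + u) / (1 + η)) := by ring
        _ ≤ _ := by
            refine mul_le_mul_of_nonneg_left ?_ (by positivity)
            have : 0 ≤ (r i + u) / (1 + η) := by positivity
            linarith
    · rw [if_neg h, if_neg h, add_zero]
      have e1 : (QState.ofWeights s (fun i => (hs i).le) hs1).mat i j = 0 :=
        Matrix.diagonal_apply_ne _ h
      have e2 : s i + s j = (r i + r j + 2 / m) / (1 + η) := by
        simp only [hsdef]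
        ring
      rw [e1, sub_zero, e2, div_div_eq_mul_div, mul_comm, mul_div_assoc]
  refine (Finset.sum_le_sum fun i _ => Finset.sum_le_sum fun j _ => hterm i j).trans_eq ?_
  simp only [Finset.sum_add_distrib, ← Finset.mul_sum, Finset.sum_ite_eq, Finset.mem_univ,
    if_true, ← Finset.sum_mul, Finset.sum_const, Finset.card_univ, nsmul_eq_mul]
  rw [show ∑ i, r i = 1 from ρ.sum_re_diag, one_mul, mul_one_div]
  rfl

end fidelity

/-! ### Error probabilities of the tester. -/

section tester

variable {ι : Type*} [Fintype ι] [DecidableEq ι]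

theorem POVM.prob_true_add_prob_false (M : POVM ι Bool) (ρ : QState ι) :
    M.prob ρ true + M.prob ρ false = 1 := by
  have h := M.sum_eq_one
  rw [Fintype.sum_bool] at h
  rw [POVM.prob, POVM.prob, ← Complex.add_re, ← Matrix.trace_add, ← Matrix.mul_add, h,
    Matrix.mul_one, ρ.trace_eq_one, Complex.one_re]

/-- Learn the diagonal from `m` copies, then threshold the correspondingly weighted exchange
observable on two blocks of `k` copies. -/
noncomputable def diagTester (ι : Type*) [Fintype ι] [DecidableEq ι] {n k m : ℕ}
    (h : k + k + m = n) (τ : ℝ) : POVM (Fin n → ι) Bool :=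
  (POVM.adaptive fun x : Fin m → ι =>
    thresholdPOVM (exchangeObs (Fin k) (invFreq x)) τ).reindex (splitCopies ι h)

variable {n k m : ℕ}

theorem iidMean_sum_invFreq_sq_le {r : ι → ℝ} (hr : ∀ i, 0 ≤ r i) (hr1 : ∑ i, r i = 1) :
    iidMean r m (fun x => ∑ i, ∑ j, invFreq x i j ^ 2 * (r i * r j)) ≤
      (Fintype.card ι : ℝ) ^ 2 / 4 := by
  rw [iidMean_sum]
  have : ∀ i, iidMean r m (fun x => ∑ j, invFreq x i j ^ 2 * (r i * r j)) ≤
      ∑ _j : ι, (1 / 4 : ℝ) := by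
    intro i
    rw [iidMean_sum]
    refine Finset.sum_le_sum fun j _ => ?_
    have e : (fun x : Fin m → ι => invFreq x i j ^ 2 * (r i * r j)) =
        fun x => (r i * r j) * invFreq x i j ^ 2 := by
      ext x
      ring
    rw [e, iidMean_const_mul, mul_comm]
    exact iidMean_invFreq_sq_mul_le hr hr1 i j
  refine (Finset.sum_le_sum fun i _ => this i).trans_eq ?_
  simp only [Finset.sum_const, Finset.card_univ, nsmul_eq_mul]
  ring

/-- Symmetry replaces r_i by (r_i + r_j)/2, after which the mixed inverse moment bounds each
off-diagonal term by a_ij/(r_i + r_j + 2/m). -/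
theorem iidMean_sum_mul_invFreq_sq_le {r : ι → ℝ} (hr : ∀ i, 0 ≤ r i) (hr1 : ∑ i, r i = 1)
    (hm : 0 < m) {a : ι → ι → ℝ} (ha : ∀ i j, 0 ≤ a i j) (hsymm : ∀ i j, a i j = a j i) :
    iidMean r m (fun x => ∑ i, ∑ j, r i * (invFreq x i j ^ 2 * a i j)) ≤
      offDiagChiSq m r a := by
  have e : (fun x : Fin m → ι => ∑ i, ∑ j, r i * (invFreq x i j ^ 2 * a i j)) =
      fun x => ∑ i, ∑ j, ((r i + r j) * a i j / 2) * invFreq x i j ^ 2 := by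
    ext x
    have h1 : ∑ i, ∑ j, r i * (invFreq x i j ^ 2 * a i j) =
        ∑ i, ∑ j, r j * (invFreq x i j ^ 2 * a i j) := by
      rw [Finset.sum_comm]
      refine Finset.sum_congr rfl fun i _ => Finset.sum_congr rfl fun j _ => ?_
      rw [hsymm, invFreq_comm]
    have h2 : ∑ i, ∑ j, ((r i + r j) * a i j / 2) * invFreq x i j ^ 2 =
        (∑ i, ∑ j, r i * (invFreq x i j ^ 2 * a i j)) / 2 +
          (∑ i, ∑ j, r j * (invFreq x i j ^ 2 * a i j)) / 2 := by
      simp only [Finset.sum_div, ← Finset.sum_add_distrib]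
      refine Finset.sum_congr rfl fun i _ => Finset.sum_congr rfl fun j _ => ?_
      ring
    rw [h2, ← h1]
    ring
  rw [e, iidMean_sum]
  refine Finset.sum_le_sum fun i _ => ?_
  rw [iidMean_sum]
  refine Finset.sum_le_sum fun j _ => ?_
  rw [iidMean_const_mul]
  have h := mul_le_mul_of_nonneg_left (iidMean_invFreq_sq_mul_add_le hr hr1 hm i j)
    (div_nonneg (ha i j) zero_le_two)
  refine (le_of_eq ?_).trans (h.trans_eq ?_)
  · ring
  · split_ifs <;> ring

theorem tensorPow_kronecker_posSemidef {ι : Type*} [Fintype ι] (ρ : QState ι)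
    (k : ℕ) :
    (tensorPowMat ρ.mat k ⊗ₖ tensorPowMat ρ.mat k).PosSemidef :=
  (tensorPowMat_posSemidef ρ.posSemidef k).kronecker (tensorPowMat_posSemidef ρ.posSemidef k)

theorem tensorPow_kronecker_trace {ι : Type*} [Fintype ι] (ρ : QState ι)
    (k : ℕ) :
    (tensorPowMat ρ.mat k ⊗ₖ tensorPowMat ρ.mat k).trace = 1 := by
  rw [Matrix.trace_kronecker, tensorPowMat_trace ρ.trace_eq_one, one_mul]

/-- The weights vanish on the diagonal, so for diagonal `ρ` only the term with collisions in both
blocks survives in the second moment. -/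
theorem diagTester_prob_false_le (h : k + k + m = n) (hk : 0 < k) {τ : ℝ} (hτ : 0 < τ)
    {ρ : QState ι} (hρ : ρ.IsDiagonal) :
    (diagTester ι h τ).prob (ρ.copies n) false ≤
      ((Fintype.card ι : ℝ) / k) ^ 2 / 4 / τ ^ 2 := by
  have : NeZero k := ⟨hk.ne'⟩
  have hr := ρ.re_diag_nonneg
  have hr1 := ρ.sum_re_diag
  have hoff : ∀ (x : Fin m → ι) i j, invFreq x i j * ‖ρ.mat i j‖ ^ 2 = 0 := by
    intro x i j
    by_cases hij : i = j
    · simp [invFreq, hij]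
    · simp [hρ hij]
  rw [diagTester, prob_reindex_adaptive ρ h]
  have hx : ∀ x : Fin m → ι, ((tensorPowMat ρ.mat k ⊗ₖ tensorPowMat ρ.mat k) *
      (thresholdPOVM (exchangeObs (Fin k) (invFreq x)) τ).effect false).trace.re ≤
      (1 / (k : ℝ) ^ 2 / τ ^ 2) *
        ∑ i, ∑ j, invFreq x i j ^ 2 * ((ρ.mat i i).re * (ρ.mat j j).re) := by
    intro x
    refine (re_trace_mul_thresholdProj_le (tensorPow_kronecker_posSemidef ρ k)
      (exchangeObs_isHermitian (invFreq_comm x)) hτ).trans ?_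
    have h2 := re_trace_mul_exchangeObs_sq_le (κ := Fin k) ρ.trace_eq_one ρ.posSemidef
      (invFreq_comm x)
    have hz : ∀ i j, (ρ.mat i i).re * (invFreq x i j ^ 2 * ‖ρ.mat i j‖ ^ 2) = 0 := by
      intro i j
      rw [pow_two (invFreq x i j), mul_assoc (invFreq x i j), hoff, mul_zero, mul_zero]
    simp only [hoff, hz, Finset.sum_const_zero, mul_zero, add_zero, Fintype.card_fin,
      zero_pow two_ne_zero, zero_add] at h2
    rw [div_mul_eq_mul_div]
    exact div_le_div_of_nonneg_right h2 (by positivity)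
  refine (iidMean_mono hr hx).trans ?_
  rw [iidMean_const_mul]
  refine (mul_le_mul_of_nonneg_left (iidMean_sum_invFreq_sq_le hr hr1)
    (by positivity)).trans_eq ?_
  ring

/-- The 1/10 pays for samples with δ < S/10; the other two terms are the averaged Chebyshev bound
when δ ≥ S/10 ≥ 2τ, where 4/δ² ≤ 400/S². -/
theorem diagTester_prob_true_le (h : k + k + m = n) (hk : 0 < k) (hm : 0 < m) {τ S : ℝ}
    (hτ : 0 < τ) {ρ : QState ι}
    (hS : S = offDiagChiSq m (fun i => (ρ.mat i i).re) (fun i j => ‖ρ.mat i j‖ ^ 2))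
    (hτS : 20 * τ ≤ S) :
    (diagTester ι h τ).prob (ρ.copies n) true ≤
      1 / 10 + 800 * (Fintype.card ι / k / S) + 100 * (Fintype.card ι / k / S) ^ 2 := by
  have : NeZero k := ⟨hk.ne'⟩
  have hr := ρ.re_diag_nonneg
  have hr1 := ρ.sum_re_diag
  have hS0 : 0 < S := by linarith
  have hk' : (0 : ℝ) < k := Nat.cast_pos.mpr hk
  set r : ι → ℝ := fun i => (ρ.mat i i).re with hrdef
  set a : ι → ι → ℝ := fun i j => ‖ρ.mat i j‖ ^ 2 with hadef
  have ha : ∀ i j, 0 ≤ a i j := fun i j => sq_nonneg _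
  have hsymm : ∀ i j, a i j = a j i := fun i j => by
    simp only [hadef, ρ.posSemidef.isHermitian.norm_apply_comm i j]
  rw [diagTester, prob_reindex_adaptive ρ h]
  have hx : ∀ x : Fin m → ι, ((tensorPowMat ρ.mat k ⊗ₖ tensorPowMat ρ.mat k) *
      (thresholdPOVM (exchangeObs (Fin k) (invFreq x)) τ).effect true).trace.re ≤
      1 / (10 * S) * chiSqDistortion r a x +
      (400 / S ^ 2 * (2 / k * Fintype.card ι) *
          (∑ i, ∑ j, r i * (invFreq x i j ^ 2 * a i j)) +
        400 / S ^ 2 * (1 / (k : ℝ) ^ 2) *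
          ∑ i, ∑ j, invFreq x i j ^ 2 * (r i * r j)) := by
    intro x
    set δ := ∑ i, ∑ j, invFreq x i j * a i j with hδ
    have hCS : S ^ 2 ≤ δ * chiSqDistortion r a x := by
      rw [hS]
      exact offDiagChiSq_sq_le hr hm ha x
    have hV : 0 ≤ ∑ i, ∑ j, r i * (invFreq x i j ^ 2 * a i j) :=
      Finset.sum_nonneg fun i _ => Finset.sum_nonneg fun j _ =>
        mul_nonneg (hr i) (mul_nonneg (sq_nonneg _) (ha i j))
    have hW : 0 ≤ ∑ i, ∑ j, invFreq x i j ^ 2 * (r i * r j) :=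
      Finset.sum_nonneg fun i _ => Finset.sum_nonneg fun j _ =>
        mul_nonneg (sq_nonneg _) (mul_nonneg (hr i) (hr j))
    have hδ0 : 0 ≤ δ := Finset.sum_nonneg fun i _ => Finset.sum_nonneg fun j _ =>
        mul_nonneg (invFreq_nonneg x i j) (ha i j)
    have hT : 0 ≤ chiSqDistortion r a x := by
      by_contra hneg
      push Not at hneg
      nlinarith [mul_nonneg hδ0 (neg_nonneg.mpr hneg.le), pow_pos hS0 2]
    set V := ∑ i, ∑ j, r i * (invFreq x i j ^ 2 * a i j)
    set W := ∑ i, ∑ j, invFreq x i j ^ 2 * (r i * r j)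
    set Z := exchangeObs (Fin k) (invFreq x)
    set R := tensorPowMat ρ.mat k ⊗ₖ tensorPowMat ρ.mat k with hR
    have hRp : R.PosSemidef := tensorPow_kronecker_posSemidef ρ k
    have hR1 : R.trace = 1 := tensorPow_kronecker_trace ρ k
    have heff : (thresholdPOVM Z τ).effect true = 1 - thresholdProj Z τ := rfl
    rw [heff]
    -- Markov's inequality done pointwise: if δ < S/10, Cauchy–Schwarz forces the distortion to be
    -- at least 10S, so the first term of the bound already exceeds any probability.
    rcases lt_or_ge δ (S / 10) with hlt | hge
    · have h1 : (R * (1 - thresholdProj Z τ)).trace.re ≤ 1 := by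
        have h2 := re_trace_mul_nonneg hRp (thresholdProj_posSemidef Z τ)
        rw [Matrix.mul_sub, Matrix.trace_sub, Matrix.mul_one, hR1, Complex.sub_re,
          Complex.one_re]
        linarith
      have h3 : 1 ≤ 1 / (10 * S) * chiSqDistortion r a x := by
        rw [one_div_mul_eq_div, one_le_div (by positivity)]
        have h4 : S ^ 2 ≤ S / 10 * chiSqDistortion r a x :=
          hCS.trans (mul_le_mul_of_nonneg_right hlt.le hT)
        have h5 : S * (10 * S) ≤ S * chiSqDistortion r a x := by nlinarith
        exact le_of_mul_le_mul_left h5 hS0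
      have h6 : 0 ≤ 400 / S ^ 2 * (2 / k * Fintype.card ι) * V +
          400 / S ^ 2 * (1 / (k : ℝ) ^ 2) * W := by positivity
      linarith
    · have hδp : 0 < δ := by linarith
      have h1 := re_trace_mul_one_sub_thresholdProj_le hRp hR1
        (exchangeObs_isHermitian (κ := Fin k) (invFreq_comm x)) hτ (μ := δ) (by linarith)
      have h2 := re_trace_mul_exchangeObs_sq_le (κ := Fin k) ρ.trace_eq_one ρ.posSemidef
        (invFreq_comm x)
      have h3 : (R * Z).trace.re = δ := by
        have := trace_mul_exchangeObs (κ := Fin k) ρ.trace_eq_one ρ.posSemidef.isHermitian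
          (invFreq x)
        rw [hR, tensorPowMat_eq_piMat, this, Complex.ofReal_re]
      rw [Fintype.card_fin] at h2
      have h4 : (R * (Z * Z)).trace.re - 2 * δ * (R * Z).trace.re + δ ^ 2 ≤
          2 / k * (Fintype.card ι * V) + 1 / (k : ℝ) ^ 2 * W := by
        rw [h3]
        have : (R * (Z * Z)).trace.re ≤
          δ ^ 2 + 2 / k * (Fintype.card ι * V) + 1 / (k : ℝ) ^ 2 * W := h2
        linarith
      have h5 : 4 / δ ^ 2 ≤ 400 / S ^ 2 := by
        rw [div_le_div_iff₀ (by positivity) (by positivity)]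
        nlinarith
      calc (R * (1 - thresholdProj Z τ)).trace.re
          ≤ 4 / δ ^ 2 * (2 / k * (Fintype.card ι * V) + 1 / (k : ℝ) ^ 2 * W) :=
            h1.trans (mul_le_mul_of_nonneg_left h4 (by positivity))
        _ ≤ 400 / S ^ 2 * (2 / k * (Fintype.card ι * V) + 1 / (k : ℝ) ^ 2 * W) :=
            mul_le_mul_of_nonneg_right h5 (by positivity)
        _ = 0 + (400 / S ^ 2 * (2 / k * Fintype.card ι) * V +
            400 / S ^ 2 * (1 / (k : ℝ) ^ 2) * W) := by ring
        _ ≤ _ := by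
            gcongr
            positivity
  refine (iidMean_mono hr hx).trans ?_
  rw [iidMean_add, iidMean_add, iidMean_const_mul, iidMean_const_mul, iidMean_const_mul]
  have t1 := iidMean_chiSqDistortion hr hr1 hm a
  have t2 := iidMean_sum_mul_invFreq_sq_le hr hr1 hm ha hsymm
  have t3 := iidMean_sum_invFreq_sq_le (m := m) hr hr1
  rw [← hS] at t1 t2
  calc _ ≤ 1 / (10 * S) * S + (400 / S ^ 2 * (2 / k * Fintype.card ι) * S +
        400 / S ^ 2 * (1 / (k : ℝ) ^ 2) * ((Fintype.card ι : ℝ) ^ 2 / 4)) := by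
        refine add_le_add ?_ (add_le_add ?_ ?_)
        · exact (mul_le_mul_of_nonneg_left t1.le (by positivity))
        · exact (mul_le_mul_of_nonneg_left t2 (by positivity))
        · exact (mul_le_mul_of_nonneg_left t3 (by positivity))
    _ = _ := by
        field_simp
        ring

end tester

/-! ### Choice of constants. -/

/-- The tester is a two-outcome measurement of `n` copies: outcome `true` reports "diagonal",
outcome `false` reports "far from diagonal". -/
theorem mainTheorem9 :
    ∃ C : ℝ, 0 < C ∧
      ∀ (d n : ℕ) (ε : ℝ), 0 < d → 0 < ε → C * (d / ε) ≤ n →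
        ∃ M : POVM (Fin n → Fin d) Bool, ∀ ρ : QState (Fin d),
          (ρ.IsDiagonal → 2 / 3 ≤ M.prob (ρ.copies n) true) ∧
          ((∀ σ : QState (Fin d), σ.IsDiagonal → ε < ρ.infidelity σ) →
            2 / 3 ≤ M.prob (ρ.copies n) false) := by
  -- With k, m ≥ n/4 this constant gives d/k, d/m ≤ ε/12000. In the far case S ≥ ε/3, so d/(kS) ≤
  -- 1/4000 and the error is at most 1/10 + 800/4000 + 100/4000² < 1/3.
  refine ⟨48000, by norm_num, fun d n ε hd hε hn => ?_⟩
  have hd' : (1 : ℝ) ≤ d := Nat.one_le_cast.mpr hd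
  -- For ε ≥ 1 no state is far, since infidelity never exceeds 1; always answering "diagonal" works.
  rcases le_or_gt 1 ε with hε1 | hε1
  · refine ⟨⟨fun b => bif b then 1 else 0, fun b => ?_, by simp⟩, fun ρ => ⟨fun _ => ?_, fun hfar => ?_⟩⟩
    · cases b
      · exact Matrix.PosSemidef.zero
      · exact Matrix.PosSemidef.one
    · simp only [POVM.prob, cond_true, Matrix.mul_one, (ρ.copies n).trace_eq_one, Complex.one_re]
      norm_num
    · obtain ⟨σ, hσ, -⟩ := ρ.exists_isDiagonal_infidelity_le one_pos
      have h1 := hfar σ hσ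
      have h2 := ρ.fidelity_nonneg σ
      rw [QState.infidelity] at h1
      linarith
  have hn1 : (48000 : ℝ) ≤ n := by
    refine le_trans ?_ hn
    have : 1 ≤ (d : ℝ) / ε := by
      rw [one_le_div hε]
      linarith
    linarith
  have hn2 : 48000 ≤ n := by exact_mod_cast hn1
  obtain ⟨k, m, hsplit, hkn, hmn⟩ : ∃ k m : ℕ, k + k + m = n ∧ n ≤ 4 * k ∧ n ≤ 4 * m :=
    ⟨n / 3, n - 2 * (n / 3), by omega, by omega, by omega⟩
  have hk : 0 < k := by omega
  have hm : 0 < m := by omega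
  have hratio : ∀ q : ℕ, 0 < q → n ≤ 4 * q → (d : ℝ) / q ≤ ε / 12000 := by
    intro q hq hq4
    have h4 : (n : ℝ) ≤ 4 * q := by exact_mod_cast hq4
    have hq' : (0 : ℝ) < q := Nat.cast_pos.mpr hq
    have h5 : 48000 * (d / ε) ≤ 4 * (q : ℝ) := hn.trans h4
    rw [div_le_iff₀ hq']
    have h6 : 48000 * (d / ε) * ε ≤ 4 * q * ε := mul_le_mul_of_nonneg_right h5 hε.le
    rw [mul_assoc, div_mul_cancel₀ _ hε.ne'] at h6
    linarith
  have hηk := hratio k hk hkn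
  have hηm := hratio m hm hmn
  have hηk0 : 0 ≤ (d : ℝ) / k := by positivity
  have hηm0 : 0 ≤ (d : ℝ) / m := by positivity
  -- The threshold is one twentieth of the lower bound ε/3 on S, as `diagTester_prob_true_le`
  -- requires.
  refine ⟨diagTester (Fin d) hsplit (ε / 60), fun ρ => ⟨fun hρ => ?_, fun hfar => ?_⟩⟩
  · have h1 := diagTester_prob_false_le hsplit hk (τ := ε / 60) (by positivity) hρ
    have h2 := (diagTester (Fin d) hsplit (ε / 60)).prob_true_add_prob_false (ρ.copies n)
    rw [Fintype.card_fin] at h1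
    have h3 : ((d : ℝ) / k) ^ 2 / 4 / (ε / 60) ^ 2 ≤ 1 / 3 := by
      rw [div_le_iff₀ (by positivity)]
      have : ((d : ℝ) / k) ^ 2 ≤ (ε / 12000) ^ 2 := by gcongr
      nlinarith
    linarith
  · obtain ⟨σ, hσ, hσle⟩ := ρ.exists_isDiagonal_infidelity_le hm
    have hlt := (hfar σ hσ).trans_le hσle
    rw [Fintype.card_fin] at hlt
    set S := offDiagChiSq m (fun i => (ρ.mat i i).re) (fun i j => ‖ρ.mat i j‖ ^ 2) with hS
    have hSε : ε / 3 ≤ S := by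
      by_contra hcon
      push Not at hcon
      have h1 : (1 + (d : ℝ) / m) * S ≤ (1 + (d : ℝ) / m) * (ε / 3) :=
        mul_le_mul_of_nonneg_left hcon.le (by positivity)
      nlinarith
    have hSpos : 0 < S := by linarith
    have h1 := diagTester_prob_true_le hsplit hk hm (τ := ε / 60) (by positivity) hS
      (by linarith)
    have h2 := (diagTester (Fin d) hsplit (ε / 60)).prob_true_add_prob_false (ρ.copies n)
    rw [Fintype.card_fin] at h1
    have h3 : (d : ℝ) / k / S ≤ 1 / 4000 := by
      rw [div_le_iff₀ hSpos]
      linarith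
    have h4 : 0 ≤ (d : ℝ) / k / S := by positivity
    nlinarith
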